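/- Let $\sigma$ be the surface measure on $\mathbb{S}^2$ ($\sigma(\mathbb{S}^2)=4\pi$), $d(s,t)=\arccos(s\cdot t)$, $P_\ell$ the Legendre polynomials, and $Y_{\ell m}$, $\ell\ge 0$, $-\ell\le m\le\ell$, the real-valued spherical harmonics, orthonormal in $L_2(\mathbb{S}^2)=L_2(\mathbb S^2,\sigma)$. Let $(A_\ell)_{\ell\ge0}$ be nonnegative reals with $\sum_\ell(2\ell+1)A_\ell<\infty$, and let $u$ be a (jointly measurable) random field on $\mathbb{S}^2$ with $$u(s)=\sum_{\ell\ge0}\sqrt{A_\ell}\sum_{m=-\ell}^{\ell}y_{\ell m}Y_{\ell m}(s),\qquad y_{\ell m}\sim\mathcal N(0,1)\ \text{i.i.d.},$$ the series converging in mean square at every $s\in\mathbb{S}^2$. Let $\mathcal H$ be the reproducing kernel Hilbert space of $u$, i.e. the completion of the span of the functions $\rho_s=\mathbb E[u(s)u(\cdot)]$, $s\in\mathbb S^2$, with respect to $\langle\rho_s,\rho_t\rangle_{\mathcal H}=\mathbb E[u(s)u(t)]$, realised as a space of functions on $\mathbb{S}^2$. *Quadratures.* For $j\in\mathbb N_0$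 let $n_j\ge1$, weights $\lambda_{jk}>0$ and points $\xi_{jk}\in\mathbb{S}^2$, $k=1,\dots,n_j$, be such that $\int_{\mathbb S^2} f\,d\sigma=\sum_k\lambda_{jk}f(\xi_{jk})$ for all polynomials $f$ of degree at most $2(2^j-1)$; $n_j\le C2^{2j}$ and $\lambda_{jk}\le c2^{-2j}$ with $C,c>0$ independent of $j$ and $k$; and, with $h_j=\sup_{s}\min_k d(s,\xi_{jk})$, $\frac14h_j\le h_{j+1}\le\frac12h_j$ and $h_j\le d(\xi_{jk},\xi_{jk'})$ for $k\ne k'$. *Cutoff.* Let $\kappa\in C^r(\mathbb R)$ be real-valued for some integer $r>2$, with $\operatorname{supp}\kappa=[\frac12,2]$ and $|\kappa(t)|^2+|\kappa(2t)|^2=1$ for $t\in[\frac12,1]$; put $b_j(\ell)=\kappa(2^{-j}(2\ell+1))$. Define the needlets and the modified needlets by $$\psi_{jk}(s)=\sqrt{\lambda_{jk}}\sum_{\ell\ge0}b_j(\ell)\sum_{m=-\ell}^{\ell}Y_{\ell m}(\xi_{jk})Y_{\ell m}(s),\qquad \psi^{\mathsf A}_{jk}(s)=\sqrt{\lambda_{jk}}\sum_{\ell\ge0}b_j(\ell)\sqrt{A_\ell}\,\frac{2\ell+1}{4\pi}P_\ell(s\cdot\xi_{jk}).$$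 Then: 1. $\psi^{\mathsf A}_{jk}=S\psi_{jk}$, where $S f=\sum_\ell\sqrt{A_\ell}\sum_m\big(\int Y_{\ell m}f\,d\sigma\big)Y_{\ell m}$ (convergent in $L_2(\mathbb{S}^2)$) is the positive square root of the covariance operator $Tf(s)=\int_{\mathbb S^2}\mathbb E[u(s)u(t)]f(t)\,d\sigma(t)$ on $L_2(\mathbb S^2)$. 2. $\psi^{\mathsf A}_{jk}\in\mathcal H$, and $\{\psi^{\mathsf A}_{jk}: j\ge0,\ k=1,\dots,n_j\}$ is a Parseval frame of $\mathcal H$: for every $f\in\mathcal H$, $\|f\|_{\mathcal H}^2=\sum_{j,k}|\langle f,\psi^{\mathsf A}_{jk}\rangle_{\mathcal H}|^2$ and $f=\sum_{j,k}\langle f,\psi^{\mathsf A}_{jk}\rangle_{\mathcal H}\,\psi^{\mathsf A}_{jk}$ in $\mathcal H$. 3. $u=\sum_{j,k}z_{jk}\psi^{\mathsf A}_{jk}$ in law with i.i.d. $\mathcal N(0,1)$ coefficients: for any i.i.d. $z_{jk}\sim\mathcal N(0,1)$, on any probability space, there is a jointly measurable random field $v$ such that, for every $s\in\mathbb S^2$,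 the series $\sum_{j,k}z_{jk}\psi^{\mathsf A}_{jk}(s)$ converges unconditionally in mean square to $v(s)$, and $v$ has the same law as $u$ (as a process indexed by $\mathbb{S}^2$). 4. $\psi^{\mathsf A}_{jk}\in L_2(\mathbb S^2)$, $\psi^{\mathsf A}_{jk}$ and $\psi^{\mathsf A}_{j'k'}$ are orthogonal in $L_2(\mathbb S^2)$ whenever $|j-j'|\ge2$, and for $j>1$ each $\psi^{\mathsf A}_{jk}$ is orthogonal in $L_2(\mathbb{S}^2)$ to all polynomials of degree less than $\frac12(2^{j-1}-1)$. -/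

import Mathlib

open MeasureTheory ProbabilityTheory Filter Topology
open scoped ENNReal

noncomputable section

namespace SphereNeedlets

/-- The unit sphere `𝕊²` in Euclidean space `ℝ³`. -/
abbrev S2 : Type := Metric.sphere (0 : EuclideanSpace ℝ (Fin 3)) 1

/-- The surface measure on `𝕊²`, of total mass `4π`. -/
def surf : Measure S2 := (volume : Measure (EuclideanSpace ℝ (Fin 3))).toSphere

/-- The inner product `s · t` of two points of the sphere. -/
def dotS (s t : S2) : ℝ :=
  inner ℝ (s : EuclideanSpace ℝ (Fin 3)) (t : EuclideanSpace ℝ (Fin 3))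

/-- The geodesic distance on the sphere. -/
def geoDist (s t : S2) : ℝ := Real.arccos (dotS s t)

/-- The value at a point of the sphere of a polynomial in the three Cartesian coordinates. -/
def polyEval (p : MvPolynomial (Fin 3) ℝ) (s : S2) : ℝ :=
  MvPolynomial.eval (fun i => (s : EuclideanSpace ℝ (Fin 3)) i) p

/-- The Legendre polynomial `P_ℓ`, by Rodrigues' formula. -/
def legendre (ℓ : ℕ) : Polynomial ℝ :=
  Polynomial.C (1 / (2 ^ ℓ * (ℓ.factorial : ℝ))) *
    (Polynomial.derivative^[ℓ] ((Polynomial.X ^ 2 - 1) ^ ℓ))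

/-- The associated Legendre function
`P_{ℓm}(x) = (-1)^m (1 - x²)^{m/2} (d/dx)^m P_ℓ(x)`, for `x ∈ [-1,1]`. -/
def assocLegendre (ℓ m : ℕ) (x : ℝ) : ℝ :=
  (-1) ^ m * Real.sqrt (1 - x ^ 2) ^ m *
    (Polynomial.derivative^[m] (legendre ℓ)).eval x

/-- The normalisation factor `N_{ℓm}`, for `m = |m|`. -/
def normFactor (ℓ m : ℕ) : ℝ :=
  Real.sqrt ((2 * (ℓ : ℝ) + 1) / (4 * Real.pi) *
    (((ℓ - m).factorial : ℝ) / ((ℓ + m).factorial : ℝ)))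

/-- The longitude `φ` of a point of the sphere. The representative in `(-π, π]` is used; only
`cos (m φ)` and `sin (m φ)` for integers `m` occur. (At the two poles the choice of `φ` is
immaterial, because `P_{ℓm}(±1) = 0` for `m ≥ 1`.) -/
def longitude (s : S2) : ℝ :=
  Complex.arg ⟨(s : EuclideanSpace ℝ (Fin 3)) 0, (s : EuclideanSpace ℝ (Fin 3)) 1⟩

/-- The real-valued spherical harmonics `Y_{ℓm}`, `-ℓ ≤ m ≤ ℓ`; the third coordinate of the point
is `cos ϑ`. -/
def sphHarm (ℓ : ℕ) (m : ℤ) (s : S2) : ℝ :=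
  if 0 < m then
    Real.sqrt 2 * normFactor ℓ m.natAbs *
      assocLegendre ℓ m.natAbs ((s : EuclideanSpace ℝ (Fin 3)) 2) *
        Real.cos ((m.natAbs : ℝ) * longitude s)
  else if m = 0 then
    normFactor ℓ 0 * (legendre ℓ).eval ((s : EuclideanSpace ℝ (Fin 3)) 2)
  else
    Real.sqrt 2 * normFactor ℓ m.natAbs *
      assocLegendre ℓ m.natAbs ((s : EuclideanSpace ℝ (Fin 3)) 2) *
        Real.sin ((m.natAbs : ℝ) * longitude s)

/-- The indices `m = -ℓ, …, ℓ`. -/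
abbrev MIndex (ℓ : ℕ) : Type := Finset.Icc (-(ℓ : ℤ)) (ℓ : ℤ)

/-- Independent standard normal random variables. -/
structure IsIIDStdNormal {ι Ω : Type*} [MeasurableSpace Ω] (P : Measure Ω) (y : ι → Ω → ℝ) :
    Prop where
  law : ∀ i, HasLaw (y i) (gaussianReal 0 1) P
  indep : iIndepFun y P

/-- `u` is a random field on the sphere with Karhunen–Loève expansion
`u = ∑_ℓ √A_ℓ ∑_m y_{ℓm} Y_{ℓm}`, `y_{ℓm}` i.i.d. standard normal; the series converges to `u(s)`
in mean square at every point `s`. -/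
structure IsIsotropicGaussianField {Ω : Type*} [MeasurableSpace Ω] (P : Measure Ω)
    (A : ℕ → ℝ) (u : Ω → S2 → ℝ) : Prop where
  measurable : Measurable (Function.uncurry u)
  expansion : ∃ y : (Σ ℓ : ℕ, MIndex ℓ) → Ω → ℝ, IsIIDStdNormal P y ∧
    ∀ s : S2, Tendsto
      (fun L : ℕ => eLpNorm
        (fun ω => u ω s - ∑ ℓ ∈ Finset.range L,
          Real.sqrt (A ℓ) * ∑ m : MIndex ℓ, y ⟨ℓ, m⟩ ω * sphHarm ℓ m s) 2 P)
      atTop (𝓝 0)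

/-- The covariance function `E[u(s) u(t)]` of a centred random field. -/
def covFun {Ω : Type*} [MeasurableSpace Ω] (P : Measure Ω) (u : Ω → S2 → ℝ) (s t : S2) : ℝ :=
  ∫ ω, u ω s * u ω t ∂P

/-- The covariance function as an (operator-valued) kernel. If it is positive semidefinite, then
`RKHS.OfKernel (covKernel P u)` is the completion of the finite linear combinations of the
functions `ρ_s = E[u(s) u(·)]` with respect to `⟨ρ_s, ρ_t⟩ = E[u(s) u(t)]`, realised as functions
on the sphere: the reproducing kernel Hilbert space of `u`. -/
def covKernel {Ω : Type*} [MeasurableSpace Ω] (P : Measure Ω) (u : Ω → S2 → ℝ) :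
    Matrix S2 S2 (ℝ →L[ℝ] ℝ) :=
  Matrix.of fun s t => covFun P u s t • ContinuousLinearMap.id ℝ ℝ

/-- Parseval frames of a real Hilbert space: the Parseval identity together with the
reconstruction formula, with convergence in the Hilbert space. -/
structure IsParsevalFrame {ι H : Type*} [NormedAddCommGroup H] [InnerProductSpace ℝ H]
    (φ : ι → H) : Prop where
  parseval : ∀ f : H, HasSum (fun i => |inner ℝ f (φ i)| ^ 2) (‖f‖ ^ 2)
  reconstruction : ∀ f : H, HasSum (fun i => inner ℝ f (φ i) • φ i) f

/-- The mesh size `sup_s min_k d(s, ξ_k)` of a finite family of points on the sphere. -/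
def meshSize {n : ℕ} (ξ : Fin n → S2) : ℝ := ⨆ s : S2, ⨅ k : Fin n, geoDist s (ξ k)

/-- The assumptions on the quadrature weights `λ_{jk}` and points `ξ_{jk}`, `k = 1, …, n_j`. -/
structure IsQuadrature (n : ℕ → ℕ) (lam : (j : ℕ) → Fin (n j) → ℝ)
    (ξ : (j : ℕ) → Fin (n j) → S2) : Prop where
  n_pos : ∀ j, 0 < n j
  lam_pos : ∀ j k, 0 < lam j k
  exact_poly : ∀ j, ∀ p : MvPolynomial (Fin 3) ℝ, p.totalDegree ≤ 2 * (2 ^ j - 1) →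
    ∫ s, polyEval p s ∂surf = ∑ k, lam j k * polyEval p (ξ j k)
  card_le : ∃ C : ℝ, 0 < C ∧ ∀ j, (n j : ℝ) ≤ C * 2 ^ (2 * j)
  mesh_lower : ∀ j, meshSize (ξ j) / 4 ≤ meshSize (ξ (j + 1))
  mesh_upper : ∀ j, meshSize (ξ (j + 1)) ≤ meshSize (ξ j) / 2
  mesh_ratio : ∀ j, ∀ k k', k ≠ k' → meshSize (ξ j) ≤ geoDist (ξ j k) (ξ j k')
  lam_le : ∃ c : ℝ, 0 < c ∧ ∀ j k, lam j k ≤ c / 2 ^ (2 * j)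

/-- The assumptions on the cutoff function `κ`. -/
structure IsCutoff (κ : ℝ → ℝ) : Prop where
  smooth : ∃ r : ℕ, 2 < r ∧ ContDiff ℝ r κ
  support : tsupport κ = Set.Icc (1 / 2) 2
  partition : ∀ t ∈ Set.Icc (1 / 2 : ℝ) 1, |κ t| ^ 2 + |κ (2 * t)| ^ 2 = 1

/-- `b_j(ℓ) = κ(2^{-j} (2ℓ + 1))`. -/
def levelWeight (κ : ℝ → ℝ) (j ℓ : ℕ) : ℝ := κ ((2 * (ℓ : ℝ) + 1) / 2 ^ j)

/-- The needlet at level `j` with quadrature weight `w` and quadrature point `x`. -/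
def needlet (κ : ℝ → ℝ) (j : ℕ) (w : ℝ) (x s : S2) : ℝ :=
  Real.sqrt w * ∑' ℓ : ℕ, levelWeight κ j ℓ * ∑ m : MIndex ℓ, sphHarm ℓ m x * sphHarm ℓ m s

/-- The modified needlet for the power spectrum `A`, at level `j` with quadrature weight `w` and
quadrature point `x`. -/
def modNeedlet (κ : ℝ → ℝ) (A : ℕ → ℝ) (j : ℕ) (w : ℝ) (x s : S2) : ℝ :=
  Real.sqrt w * ∑' ℓ : ℕ, levelWeight κ j ℓ * Real.sqrt (A ℓ) *
    ((2 * (ℓ : ℝ) + 1) / (4 * Real.pi)) * (legendre ℓ).eval (dotS s x)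

/-- `S` is the positive square root of the covariance operator
`T f (s) = ∫ E[u(s) u(t)] f(t) dσ(t)` on `L²(𝕊²)`, and it acts on spherical harmonics expansions by
`S f = ∑_ℓ √A_ℓ ∑_m (∫ Y_{ℓm} f dσ) Y_{ℓm}`, with convergence in `L²(𝕊²)`. -/
structure IsCovSqrt {Ω : Type*} [MeasurableSpace Ω] (P : Measure Ω) (A : ℕ → ℝ)
    (u : Ω → S2 → ℝ) (S : Lp ℝ 2 surf →L[ℝ] Lp ℝ 2 surf) : Prop where
  positive : S.IsPositive
  square : ∀ f : Lp ℝ 2 surf, (S (S f) : S2 → ℝ) =ᵐ[surf] fun s => ∫ t, covFun P u s t * f t ∂surf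
  expansion : ∀ f : Lp ℝ 2 surf, Tendsto
    (fun L : ℕ => eLpNorm
      (fun s => S f s - ∑ ℓ ∈ Finset.range L,
        Real.sqrt (A ℓ) * ∑ m : MIndex ℓ, (∫ t, sphHarm ℓ m t * f t ∂surf) * sphHarm ℓ m s) 2 surf)
    atTop (𝓝 0)

end SphereNeedlets

end

open SphereNeedlets

/-!
# Modified needlets for isotropic Gaussian random fields

Everything reduces to the coefficient space `ℓ²` over the indices `(ℓ, m)`. The random field has
the coefficient sequences `g s = (√A_ℓ Y_{ℓm}(s))` (`ampVec`), and `E[u(s) u(t)] = ⟪g s, g t⟫`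
(`inner_ampVec`), so its reproducing kernel Hilbert space embeds isometrically into `ℓ²` with the
kernel function at `s` going to `g s`. The needlets have the finitely supported coefficient
sequences `√λ b_j(ℓ) Y_{ℓm}(ξ)` (`needletCoeff`), whose inner products with `g s` are the values of
the modified needlets (`inner_needletCoeff_ampVec`).

The needlet sequences form a Parseval family of `ℓ²` (`hasSum_inner_needletCoeff_sq`): at level `j`
the square of a spherical polynomial of degree at most `2 ^ j - 1` is integrated exactly by the
quadrature rule, which gives the energy `∑ b_j(ℓ)² a_{ℓm}²`, and the squares of the cutoffs sum to
`1` over the levels. Pulling the family back by the adjoint of the isometry gives the Parseval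
frame of the reproducing kernel Hilbert space; polarizing gives `E[u(s) u(t)] = ∑ ψ(s) ψ(t)`
(`hasSum_modNeedlet_mul`). As the mean square limits of Gaussian series have a law determined by
their covariance (`identDistrib_of_isMeanSquareLimit`), the series `∑ z ψ` has the law of `u`. Its
jointly measurable version is a limit along one subsequence of the levels that serves all points at
once, because by the addition theorem the mean square error after a given level is the same at
every point. The statements about `L²(𝕊²)` follow from the spectral form of the operators and of
the needlets.

The facts needed about spherical harmonics are proved from their definition. Orthonormality
(`integral_harm_mul`) comes from integration in spherical coordinates and Rodrigues' formula; a
dimension count then shows that the harmonics of degree at most `N` span the polynomials of degree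
at most `N` (`polySpace_eq_span`). Hence the sum of `Y_{ℓm}(s) Y_{ℓm}(t)` over these harmonics is
the reproducing kernel of a rotation-invariant space and is itself rotation-invariant. Subtracting
the kernels for consecutive degrees, and evaluating with `t` at the north pole, gives the addition
theorem (`zonal_eq_legendre`).
-/

namespace SphereNeedlets

/-! ### Legendre polynomials on `[-1, 1]` -/

section Legendre

open Polynomial

/-- The integral over `[-1, 1]` as a linear functional on polynomials. -/
noncomputable def intPoly (p : ℝ[X]) : ℝ := ∫ x in (-1 : ℝ)..1, p.eval x

lemma intPoly_add (p q : ℝ[X]) : intPoly (p + q) = intPoly p + intPoly q := by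
  simp only [intPoly, eval_add]
  exact intervalIntegral.integral_add (p.continuous.intervalIntegrable _ _)
    (q.continuous.intervalIntegrable _ _)

lemma intPoly_C_mul (c : ℝ) (p : ℝ[X]) : intPoly (C c * p) = c * intPoly p := by
  simp [intPoly]

lemma intPoly_derivative (p : ℝ[X]) : intPoly (derivative p) = p.eval 1 - p.eval (-1) := by
  rw [intPoly]
  exact intervalIntegral.integral_eq_sub_of_hasDerivAt (fun x _ => p.hasDerivAt x)
    ((derivative p).continuous.intervalIntegrable _ _)

lemma intPoly_derivative_mul {p q : ℝ[X]} (h : (X ^ 2 - 1 : ℝ[X]) ∣ p) :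
    intPoly (derivative p * q) = -intPoly (p * derivative q) := by
  obtain ⟨r, rfl⟩ := h
  have h0 := intPoly_derivative ((X ^ 2 - 1) * r * q)
  rw [derivative_mul, intPoly_add] at h0
  simp only [eval_mul, eval_sub, eval_pow, eval_X, eval_one] at h0
  linarith [h0]

/-- Repeated integration by parts against a factor vanishing to high order at `±1`. -/
lemma intPoly_iterate_derivative_mul (m : ℕ) : ∀ {n : ℕ} {p q : ℝ[X]}, m ≤ n →
    (X ^ 2 - 1 : ℝ[X]) ^ n ∣ p →
    intPoly (derivative^[m] p * q) = (-1) ^ m * intPoly (p * derivative^[m] q) := by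
  induction m with
  | zero => intro n p q _ _; simp
  | succ m ih =>
    intro n p q hmn hp
    have h1 : (X ^ 2 - 1 : ℝ[X]) ∣ derivative^[m] p :=
      (dvd_pow_self _ (by omega)).trans (pow_sub_dvd_iterate_derivative_of_pow_dvd m hp)
    rw [Function.iterate_succ_apply', intPoly_derivative_mul h1, ih (by omega) hp,
      ← Function.iterate_succ_apply]
    ring

lemma iterate_derivative_of_natDegree_le {n : ℕ} {r : ℝ[X]} (h : r.natDegree ≤ n) :
    derivative^[n] r = C ((n.factorial : ℝ) * r.coeff n) := by
  have hd : (derivative^[n] r).natDegree = 0 := by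
    have := natDegree_iterate_derivative r n
    omega
  rw [eq_C_of_natDegree_eq_zero hd, coeff_iterate_derivative]
  simp [Nat.descFactorial_self]

lemma natDegree_sq_sub_one_pow (n : ℕ) : ((X ^ 2 - 1 : ℝ[X]) ^ n).natDegree = 2 * n := by
  rw [natDegree_pow, show (X ^ 2 - 1 : ℝ[X]) = X ^ 2 - C 1 by simp, natDegree_X_pow_sub_C, mul_comm]

lemma monic_sq_sub_one_pow (n : ℕ) : ((X ^ 2 - 1 : ℝ[X]) ^ n).Monic := by
  refine Monic.pow ?_ n
  rw [show (X ^ 2 - 1 : ℝ[X]) = X ^ 2 - C 1 by simp]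
  exact monic_X_pow_sub_C _ (by norm_num)

lemma natDegree_legendre_le (l : ℕ) : (legendre l).natDegree ≤ l := by
  refine (natDegree_C_mul_le _ _).trans ((natDegree_iterate_derivative _ _).trans ?_)
  rw [natDegree_sq_sub_one_pow]
  omega

lemma coeff_legendre (l : ℕ) :
    (legendre l).coeff l = ((2 * l).factorial : ℝ) / (2 ^ l * (l.factorial : ℝ) ^ 2) := by
  have h1 : ((X ^ 2 - 1 : ℝ[X]) ^ l).coeff (l + l) = 1 := by
    have := (monic_sq_sub_one_pow l).coeff_natDegree
    rwa [natDegree_sq_sub_one_pow, two_mul] at this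
  have h2 : ((l + l).descFactorial l : ℝ) * (l.factorial : ℝ) = ((2 * l).factorial : ℝ) := by
    have := Nat.factorial_mul_descFactorial (show l ≤ l + l by omega)
    rw [Nat.add_sub_cancel] at this
    rw [two_mul]
    exact_mod_cast (mul_comm _ _).trans this
  rw [legendre, coeff_C_mul, coeff_iterate_derivative, h1, ← h2]
  have : (l.factorial : ℝ) ≠ 0 := by positivity
  simp only [nsmul_eq_mul, mul_one]
  field_simp

lemma intPoly_sq_sub_one_pow (l : ℕ) :
    (-1) ^ l * intPoly ((X ^ 2 - 1) ^ l) =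
      2 ^ (2 * l + 1) * (l.factorial : ℝ) ^ 2 / ((2 * l + 1).factorial : ℝ) := by
  induction l with
  | zero => simp [intPoly]; norm_num
  | succ l ih =>
    -- integrate the derivative of `x (x² - 1)^{l+1}`
    have h := intPoly_derivative (X * (X ^ 2 - 1) ^ (l + 1))
    have h2 : derivative (X * (X ^ 2 - 1 : ℝ[X]) ^ (l + 1)) =
        C (2 * (l : ℝ) + 3) * (X ^ 2 - 1) ^ (l + 1) + C (2 * (l : ℝ) + 2) * (X ^ 2 - 1) ^ l := by
      simp only [derivative_mul, derivative_X, derivative_pow, derivative_sub, derivative_one,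
        map_add, map_mul, map_natCast, Nat.add_sub_cancel]
      simp only [Nat.cast_add, Nat.cast_one, Nat.cast_ofNat,
        map_ofNat]
      ring
    rw [h2, intPoly_add, intPoly_C_mul, intPoly_C_mul] at h
    simp only [eval_mul, eval_X, eval_pow, eval_sub, eval_one] at h
    have h3 : (2 * (l : ℝ) + 3) * intPoly ((X ^ 2 - 1) ^ (l + 1)) =
        -((2 * (l : ℝ) + 2) * intPoly ((X ^ 2 - 1) ^ l)) := by
      norm_num at h
      linarith
    have h4 : (-1 : ℝ) ^ (l + 1) * intPoly ((X ^ 2 - 1) ^ (l + 1)) =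
        (2 * (l : ℝ) + 2) / (2 * l + 3) * ((-1) ^ l * intPoly ((X ^ 2 - 1) ^ l)) := by
      have : (2 * (l : ℝ) + 3) ≠ 0 := by positivity
      field_simp
      rw [pow_succ]
      linear_combination (-(-1) ^ l) * h3
    rw [h4, ih, show 2 * (l + 1) + 1 = (2 * l + 1) + 1 + 1 by ring,
      Nat.factorial_succ (2 * l + 1 + 1), Nat.factorial_succ (2 * l + 1), Nat.factorial_succ l]
    have : ((2 * l + 1).factorial : ℝ) ≠ 0 := by positivity
    push_cast
    field_simp
    ring

/-- A polynomial of degree at most `l` pairs with `P_l` only through its leading coefficient. -/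
lemma intPoly_mul_legendre {l : ℕ} {r : ℝ[X]} (h : r.natDegree ≤ l) :
    intPoly (r * legendre l) =
      r.coeff l * (2 ^ (l + 1) * (l.factorial : ℝ) ^ 2 / ((2 * l + 1).factorial : ℝ)) := by
  have h1 : r * legendre l = C (1 / (2 ^ l * (l.factorial : ℝ))) *
      (derivative^[l] ((X ^ 2 - 1) ^ l) * r) := by
    rw [legendre]; ring
  rw [h1, intPoly_C_mul, intPoly_iterate_derivative_mul l le_rfl dvd_rfl,
    iterate_derivative_of_natDegree_le h, mul_comm _ (C _), intPoly_C_mul]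
  have h2 := intPoly_sq_sub_one_pow l
  have h3 : (1 / (2 ^ l * (l.factorial : ℝ))) * ((-1) ^ l * ((l.factorial : ℝ) * r.coeff l *
      intPoly ((X ^ 2 - 1) ^ l))) = (1 / 2 ^ l) * r.coeff l *
        ((-1) ^ l * intPoly ((X ^ 2 - 1) ^ l)) := by
    have : (l.factorial : ℝ) ≠ 0 := by positivity
    field_simp
  rw [h3, h2]
  field_simp
  ring

lemma natDegree_iterate_derivative_legendre_le (l m : ℕ) :
    (derivative^[m] (legendre l)).natDegree ≤ l - m :=
  (natDegree_iterate_derivative _ _).trans (Nat.sub_le_sub_right (natDegree_legendre_le l) m)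

/-- The orthogonality relation behind the associated Legendre functions. -/
lemma intPoly_assoc_of_le {l l' m : ℕ} (hm : m ≤ l) (hl : l ≤ l') :
    intPoly ((1 - X ^ 2) ^ m * derivative^[m] (legendre l) * derivative^[m] (legendre l')) =
      if l = l' then 2 / (2 * (l : ℝ) + 1) * (((l + m).factorial : ℝ) / ((l - m).factorial : ℝ))
        else 0 := by
  set q : ℝ[X] := (X ^ 2 - 1) ^ m * derivative^[m] (legendre l) with hq
  have hqdeg : q.natDegree ≤ l + m := by
    refine natDegree_mul_le.trans ?_
    rw [natDegree_sq_sub_one_pow]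
    have := natDegree_iterate_derivative_legendre_le l m
    omega
  have hqcoeff : q.coeff (l + m) = (l.descFactorial m : ℝ) * (legendre l).coeff l := by
    have h := coeff_mul_add_eq_of_natDegree_le (natDegree_sq_sub_one_pow m).le
      (natDegree_iterate_derivative_legendre_le l m)
    rw [show 2 * m + (l - m) = l + m by omega] at h
    have h1 := (monic_sq_sub_one_pow m).coeff_natDegree
    rw [natDegree_sq_sub_one_pow] at h1
    rw [hq, h, h1, coeff_iterate_derivative, show l - m + m = l by omega]
    simp
  have hr : (derivative^[m] q).natDegree ≤ l := by
    have := natDegree_iterate_derivative q m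
    omega
  have h1 : (1 - X ^ 2 : ℝ[X]) ^ m * derivative^[m] (legendre l) * derivative^[m] (legendre l') =
      C ((-1) ^ m) * (q * derivative^[m] (legendre l')) := by
    rw [hq, show (1 - X ^ 2 : ℝ[X]) = C (-1) * (X ^ 2 - 1) by simp, mul_pow, ← C_pow]
    ring
  have h2 : intPoly (derivative^[m] q * legendre l') =
      intPoly ((1 - X ^ 2) ^ m * derivative^[m] (legendre l) * derivative^[m] (legendre l')) := by
    rw [h1, intPoly_C_mul,
      intPoly_iterate_derivative_mul m le_rfl (show (X ^ 2 - 1 : ℝ[X]) ^ m ∣ q from ⟨_, hq⟩)]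
  rw [← h2, intPoly_mul_legendre (hr.trans hl), coeff_iterate_derivative]
  split_ifs with hll
  · subst hll
    rw [hqcoeff, coeff_legendre]
    have e1 : ((l + m).descFactorial m : ℝ) * (l.factorial : ℝ) = ((l + m).factorial : ℝ) := by
      have := Nat.factorial_mul_descFactorial (show m ≤ l + m by omega)
      rw [Nat.add_sub_cancel] at this
      exact_mod_cast (mul_comm _ _).trans this
    have e2 : (l.descFactorial m : ℝ) * ((l - m).factorial : ℝ) = (l.factorial : ℝ) := by
      have := Nat.factorial_mul_descFactorial hm
      exact_mod_cast (mul_comm _ _).trans this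
    have e3 : ((2 * l + 1).factorial : ℝ) = (2 * l + 1) * ((2 * l).factorial : ℝ) := by
      rw [Nat.factorial_succ]; push_cast; ring
    rw [← e1, e3]
    have : (l.factorial : ℝ) ≠ 0 := by positivity
    have : ((l - m).factorial : ℝ) ≠ 0 := by positivity
    have : ((2 * l).factorial : ℝ) ≠ 0 := by positivity
    have e4 : (l.descFactorial m : ℝ) = (l.factorial : ℝ) / ((l - m).factorial : ℝ) := by
      rw [← e2]; field_simp
    rw [e4, nsmul_eq_mul]
    field_simp
    ring
  · have : q.coeff (l' + m) = 0 := coeff_eq_zero_of_natDegree_lt (by omega)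
    rw [this]; simp

lemma intPoly_assoc {l l' m : ℕ} (hm : m ≤ l) (hm' : m ≤ l') :
    intPoly ((1 - X ^ 2) ^ m * derivative^[m] (legendre l) * derivative^[m] (legendre l')) =
      if l = l' then 2 / (2 * (l : ℝ) + 1) * (((l + m).factorial : ℝ) / ((l - m).factorial : ℝ))
        else 0 := by
  rcases le_total l l' with h | h
  · exact intPoly_assoc_of_le hm h
  · rw [mul_right_comm, intPoly_assoc_of_le hm' h]
    by_cases hll : l = l'
    · subst hll; rfl
    · rw [if_neg hll, if_neg (Ne.symm hll)]

lemma eval_one_legendre (l : ℕ) : (legendre l).eval 1 = 1 := by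
  have h : (X ^ 2 - 1 : ℝ[X]) ^ l = (X - C 1) ^ l * (X + C 1) ^ l := by
    rw [← mul_pow]; congr 1; simp; ring
  -- only the term differentiating `(X - 1)^l` exactly `l` times survives at `1`
  have h1 : (derivative^[l] ((X ^ 2 - 1 : ℝ[X]) ^ l)).eval 1 = l.factorial * 2 ^ l := by
    rw [h, iterate_derivative_mul, eval_finsetSum, Finset.sum_eq_single 0]
    · rw [Nat.sub_zero, iterate_derivative_X_sub_pow_self]
      simp
      norm_num
    · intro k hk hk0
      rw [iterate_derivative_X_sub_pow]
      have hk' : k ≤ l := by simpa [Nat.lt_succ_iff] using hk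
      have : l - (l - k) ≠ 0 := by omega
      simp [this]
    · simp
  rw [legendre, eval_mul, h1, eval_C]
  have : (l.factorial : ℝ) ≠ 0 := by positivity
  field_simp

end Legendre

/-! ### The surface measure in spherical coordinates, and its rotation invariance -/

section SurfaceMeasure

open scoped Pointwise

/-- The point of the sphere with colatitude `θ` and longitude `φ`. -/
noncomputable def spherePoint (p : ℝ × ℝ) : S2 :=
  ⟨!₂[Real.sin p.1 * Real.cos p.2, Real.sin p.1 * Real.sin p.2, Real.cos p.1], by
    rw [mem_sphere_zero_iff_norm, EuclideanSpace.norm_eq, Real.sqrt_eq_one, Fin.sum_univ_three]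
    simp only [Real.norm_eq_abs, sq_abs]
    simp only [Matrix.cons_val_zero, Matrix.cons_val_one, Matrix.cons_val]
    nlinarith [Real.sin_sq_add_cos_sq p.1, Real.sin_sq_add_cos_sq p.2]⟩

lemma continuous_spherePoint : Continuous spherePoint := by
  refine Continuous.subtype_mk ?_ _
  refine (PiLp.continuous_toLp 2 _).comp (continuous_pi fun i => ?_)
  fin_cases i <;> simp <;> fun_prop

lemma measurePreserving_cartesian :
    MeasurePreserving (fun p : ℝ × (ℝ × ℝ) => (!₂[p.2.1, p.2.2, p.1] : EuclideanSpace ℝ (Fin 3)))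
      volume volume := by
  have h1 := (MeasurePreserving.id (volume : Measure ℝ)).prod
    ((volume_preserving_finTwoArrow ℝ).symm)
  have h2 := (volume_preserving_piFinSuccAbove (fun _ : Fin 3 => ℝ) 2).symm
  have h3 := (PiLp.volume_preserving_toLp (Fin 3)).comp (h2.comp h1)
  have h4 : (fun p : ℝ × (ℝ × ℝ) => (!₂[p.2.1, p.2.2, p.1] : EuclideanSpace ℝ (Fin 3))) =
      WithLp.toLp 2 ∘ (MeasurableEquiv.piFinSuccAbove (fun _ : Fin 3 => ℝ) 2).symm ∘
        Prod.map id MeasurableEquiv.finTwoArrow.symm := by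
    funext p
    ext i
    fin_cases i <;> rfl
  rw [h4]
  exact h3

/-- The solid cone over a subset of the sphere, truncated by the unit ball. -/
def coneOver (E : Set S2) : Set (EuclideanSpace ℝ (Fin 3)) :=
  {x | ∃ r ∈ Set.Ioo (0 : ℝ) 1, ∃ s ∈ E, r • (s : EuclideanSpace ℝ (Fin 3)) = x}

lemma coneOver_eq (E : Set S2) :
    coneOver E = Set.Ioo (0 : ℝ) 1 • ((↑) '' E : Set (EuclideanSpace ℝ (Fin 3))) := by
  ext x
  simp [coneOver, Set.mem_smul]

lemma surf_apply {E : Set S2} (hE : MeasurableSet E) : surf E = 3 * volume (coneOver E) := by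
  rw [surf, Measure.toSphere_apply' _ hE, coneOver_eq]
  simp

lemma measurableSet_coneOver {E : Set S2} (hE : MeasurableSet E) :
    MeasurableSet (coneOver E) := by
  have h := ((MeasurableEmbedding.subtype_coe
    (measurableSet_singleton (0 : EuclideanSpace ℝ (Fin 3))).compl).comp
      (homeomorphUnitSphereProd (EuclideanSpace ℝ (Fin 3))).symm.measurableEmbedding)
  convert h.measurableSet_image.2 (hE.prod (measurableSet_Iio (a := ⟨1, Set.mem_Ioi.2 one_pos⟩)))
  ext x
  constructor
  · rintro ⟨r, hr, s, hs, rfl⟩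
    exact ⟨(s, ⟨r, hr.1⟩), ⟨hs, hr.2⟩, rfl⟩
  · rintro ⟨⟨s, r⟩, ⟨hs, hr⟩, rfl⟩
    exact ⟨r, ⟨r.2, hr⟩, s, hs, rfl⟩

lemma smul_mem_coneOver {E : Set S2} {r : ℝ} (hr : 0 < r) (s : S2) :
    r • (s : EuclideanSpace ℝ (Fin 3)) ∈ coneOver E ↔ r < 1 ∧ s ∈ E := by
  constructor
  · rintro ⟨r', ⟨h0, h1⟩, s', hs', h⟩
    have hn := congrArg norm h
    rw [norm_smul, norm_smul, norm_eq_of_mem_sphere, norm_eq_of_mem_sphere, mul_one, mul_one,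
      Real.norm_of_nonneg h0.le, Real.norm_of_nonneg hr.le] at hn
    subst hn
    have : s' = s := Subtype.ext (smul_right_injective _ h0.ne' h)
    exact ⟨h1, this ▸ hs'⟩
  · rintro ⟨h1, h2⟩
    exact ⟨r, ⟨hr, h1⟩, s, h2, rfl⟩

lemma lintegral_sq_Ioo :
    ∫⁻ r in Set.Ioi (0 : ℝ), ENNReal.ofReal (r ^ 2) * (Set.Iio (1 : ℝ)).indicator 1 r =
      ENNReal.ofReal (1 / 3) := by
  have h1 : ∀ r : ℝ, ENNReal.ofReal (r ^ 2) * (Set.Iio (1 : ℝ)).indicator 1 r =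
      (Set.Iio (1 : ℝ)).indicator (fun r => ENNReal.ofReal (r ^ 2)) r := by
    intro r
    by_cases h : r ∈ Set.Iio (1 : ℝ) <;> simp [h]
  simp_rw [h1]
  rw [lintegral_indicator measurableSet_Iio, Measure.restrict_restrict measurableSet_Iio,
    Set.inter_comm, Set.Ioi_inter_Iio, restrict_Ioo_eq_restrict_Ioc,
    ← ofReal_integral_eq_lintegral_ofReal, ← intervalIntegral.integral_of_le zero_le_one,
    integral_pow]
  · norm_num
  · exact (intervalIntegral.intervalIntegrable_pow 2).1
  · exact Eventually.of_forall fun r => sq_nonneg r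

/-- The colatitude part `sin θ dθ` of the surface measure. -/
noncomputable def colatMeasure : Measure ℝ :=
  (volume.restrict (Set.Ioo 0 Real.pi)).withDensity fun θ => ENNReal.ofReal (Real.sin θ)

/-- The longitude part `dφ` of the surface measure. -/
noncomputable def longMeasure : Measure ℝ := volume.restrict (Set.Ioo (-Real.pi) Real.pi)

instance : SFinite colatMeasure := by unfold colatMeasure; infer_instance

instance : IsFiniteMeasure longMeasure := by unfold longMeasure; infer_instance

instance : IsFiniteMeasure surf := by unfold surf; infer_instance

/-- The polar change of variables in a half plane containing the axis of the sphere. -/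
lemma lintegral_halfPlane {E : Set S2} (hE : MeasurableSet E) (φ : ℝ) :
    ∫⁻ z : ℝ, ∫⁻ ρ in Set.Ioi (0 : ℝ), ENNReal.ofReal ρ *
        (coneOver E).indicator 1 !₂[ρ * Real.cos φ, ρ * Real.sin φ, z] =
      ENNReal.ofReal (1 / 3) *
        ∫⁻ θ in Set.Ioo 0 Real.pi, ENNReal.ofReal (Real.sin θ) *
          E.indicator 1 (spherePoint (θ, φ)) := by
  have hC := measurableSet_coneOver hE
  let g : ℝ × ℝ → ℝ≥0∞ := fun p => (Set.Ioi (0 : ℝ)).indicator 1 p.2 * (ENNReal.ofReal p.2 *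
    (coneOver E).indicator 1 !₂[p.2 * Real.cos φ, p.2 * Real.sin φ, p.1])
  have hc : Continuous (fun p : ℝ × ℝ =>
      (!₂[p.2 * Real.cos φ, p.2 * Real.sin φ, p.1] : EuclideanSpace ℝ (Fin 3))) := by
    refine (PiLp.continuous_toLp 2 _).comp (continuous_pi fun i => ?_)
    fin_cases i <;> simp <;> fun_prop
  have hg : Measurable g := by
    refine Measurable.mul ?_ (Measurable.mul ?_ ?_)
    · exact (measurable_one.indicator measurableSet_Ioi).comp measurable_snd
    · exact measurable_snd.ennreal_ofReal
    · exact (measurable_one.indicator hC).comp hc.measurable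
  have h1 : ∫⁻ z : ℝ, ∫⁻ ρ in Set.Ioi (0 : ℝ), ENNReal.ofReal ρ *
        (coneOver E).indicator 1 !₂[ρ * Real.cos φ, ρ * Real.sin φ, z] = ∫⁻ p, g p := by
    rw [Measure.volume_eq_prod, lintegral_prod _ hg.aemeasurable]
    refine lintegral_congr fun z => ?_
    rw [← lintegral_indicator measurableSet_Ioi]
    refine lintegral_congr fun ρ => ?_
    by_cases h : ρ ∈ Set.Ioi (0 : ℝ)
    · rw [Set.indicator_of_mem h]; simp [g, Set.mem_Ioi.1 h]
    · rw [Set.indicator_of_notMem h]; simp only [g, Set.indicator_of_notMem h, zero_mul]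
  have hg2 : Measurable fun p : ℝ × ℝ => ENNReal.ofReal p.1 • g (polarCoord.symm p) := by
    refine Measurable.mul measurable_fst.ennreal_ofReal
      (hg.comp continuous_polarCoord_symm.measurable)
  rw [h1, ← lintegral_comp_polarCoord_symm, polarCoord_target, Measure.volume_eq_prod,
    ← Measure.prod_restrict, lintegral_prod_symm _ hg2.aemeasurable]
  have h2 : ∀ θ ∈ Set.Ioo (-Real.pi) Real.pi,
      ∫⁻ r in Set.Ioi (0 : ℝ), ENNReal.ofReal r • g (polarCoord.symm (r, θ)) =
      (Set.Ioo 0 Real.pi).indicator (fun θ => ENNReal.ofReal (1 / 3) *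
        (ENNReal.ofReal (Real.sin θ) * E.indicator 1 (spherePoint (θ, φ)))) θ := by
    intro θ hθ
    by_cases h0 : θ ∈ Set.Ioo 0 Real.pi
    · have hs : 0 < Real.sin θ := Real.sin_pos_of_mem_Ioo h0
      rw [Set.indicator_of_mem h0, ← lintegral_sq_Ioo,
        ← lintegral_mul_const _ (by
          refine Measurable.mul (by fun_prop) (measurable_one.indicator measurableSet_Iio))]
      refine setLIntegral_congr_fun measurableSet_Ioi fun r hr => ?_
      have hr : 0 < r := hr
      have hpt : (!₂[r * Real.sin θ * Real.cos φ, r * Real.sin θ * Real.sin φ, r * Real.cos θ] :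
          EuclideanSpace ℝ (Fin 3)) = r • (spherePoint (θ, φ) : EuclideanSpace ℝ (Fin 3)) := by
        ext i
        fin_cases i <;> simp [spherePoint, mul_assoc]
      have hrs : 0 < r * Real.sin θ := mul_pos hr hs
      have hind : (coneOver E).indicator (1 : EuclideanSpace ℝ (Fin 3) → ℝ≥0∞)
          (r • (spherePoint (θ, φ) : EuclideanSpace ℝ (Fin 3))) =
          (Set.Iio (1 : ℝ)).indicator 1 r * E.indicator 1 (spherePoint (θ, φ)) := by
        by_cases h : r < 1 ∧ spherePoint (θ, φ) ∈ E
        · rw [Set.indicator_of_mem ((smul_mem_coneOver hr _).2 h),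
            Set.indicator_of_mem (Set.mem_Iio.2 h.1), Set.indicator_of_mem h.2]
          simp
        · rw [Set.indicator_of_notMem (fun h' => h ((smul_mem_coneOver hr _).1 h'))]
          rcases not_and_or.1 h with h | h
          · rw [Set.indicator_of_notMem (s := Set.Iio 1) (by simpa using h), zero_mul]
          · rw [Set.indicator_of_notMem h, mul_zero]
      simp only [g, polarCoord_symm_apply, smul_eq_mul]
      rw [Set.indicator_of_mem (Set.mem_Ioi.2 hrs), hpt, hind, ENNReal.ofReal_mul hr.le, pow_two,
        ENNReal.ofReal_mul hr.le]
      simp only [Pi.one_apply]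
      ring
    · rw [Set.indicator_of_notMem h0]
      have hs : Real.sin θ ≤ 0 := by
        have : θ ≤ 0 := by
          by_contra h
          exact h0 ⟨not_le.1 h, hθ.2⟩
        exact Real.sin_nonpos_of_nonpos_of_neg_pi_le this hθ.1.le
      rw [← lintegral_zero]
      refine setLIntegral_congr_fun measurableSet_Ioi fun r hr => ?_
      have hr : 0 < r := hr
      have : r * Real.sin θ ∉ Set.Ioi (0 : ℝ) := by
        simp only [Set.mem_Ioi, not_lt]
        exact mul_nonpos_of_nonneg_of_nonpos hr.le hs
      simp only [g, polarCoord_symm_apply, Set.indicator_of_notMem this, zero_mul, smul_zero]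
  rw [setLIntegral_congr_fun measurableSet_Ioo h2, lintegral_indicator measurableSet_Ioo,
    Measure.restrict_restrict measurableSet_Ioo,
    Set.inter_eq_left.2 (Set.Ioo_subset_Ioo (by linarith [Real.pi_pos]) le_rfl),
    lintegral_const_mul']
  exact ENNReal.ofReal_ne_top

/-- The surface measure is `sin θ dθ dφ` in spherical coordinates. As it is defined by volumes of
cones, this follows from the planar polar change of variables, used once in the horizontal planes and
once in the half planes through the axis. -/
theorem surf_eq_map : surf = (colatMeasure.prod longMeasure).map spherePoint := by
  refine Measure.ext fun E hE => ?_
  have hC := measurableSet_coneOver hE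
  rw [surf_apply hE, Measure.map_apply continuous_spherePoint.measurable hE,
    Measure.prod_apply_symm (continuous_spherePoint.measurable hE)]
  have hm : Measurable fun p : ℝ × (ℝ × ℝ) =>
      (coneOver E).indicator (1 : EuclideanSpace ℝ (Fin 3) → ℝ≥0∞) !₂[p.2.1, p.2.2, p.1] :=
    (measurable_one.indicator hC).comp measurePreserving_cartesian.measurable
  have h1 : volume (coneOver E) = ∫⁻ z : ℝ, ∫⁻ q : ℝ × ℝ, (coneOver E).indicator 1
      (!₂[q.1, q.2, z] : EuclideanSpace ℝ (Fin 3)) := by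
    rw [← lintegral_indicator_one hC, ← measurePreserving_cartesian.lintegral_comp
      (measurable_one.indicator hC), Measure.volume_eq_prod, lintegral_prod _ hm.aemeasurable]
  have hc : Continuous (fun p : ℝ × ℝ × ℝ =>
      (!₂[p.2.2 * Real.cos p.2.1, p.2.2 * Real.sin p.2.1, p.1] : EuclideanSpace ℝ (Fin 3))) := by
    refine (PiLp.continuous_toLp 2 _).comp (continuous_pi fun i => ?_)
    fin_cases i <;> simp <;> fun_prop
  have hm3 : Measurable fun p : ℝ × ℝ × ℝ => ENNReal.ofReal p.2.2 *
      (coneOver E).indicator 1 !₂[p.2.2 * Real.cos p.2.1, p.2.2 * Real.sin p.2.1, p.1] :=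
    Measurable.mul (by fun_prop) ((measurable_one.indicator hC).comp hc.measurable)
  have h2 : ∀ z : ℝ, ∫⁻ q : ℝ × ℝ, (coneOver E).indicator 1
      (!₂[q.1, q.2, z] : EuclideanSpace ℝ (Fin 3)) =
      ∫⁻ φ, ∫⁻ ρ in Set.Ioi (0 : ℝ), ENNReal.ofReal ρ *
        (coneOver E).indicator 1 !₂[ρ * Real.cos φ, ρ * Real.sin φ, z] ∂volume ∂longMeasure := by
    intro z
    rw [← lintegral_comp_polarCoord_symm, polarCoord_target, Measure.volume_eq_prod,
      ← Measure.prod_restrict, lintegral_prod_symm]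
    · simp only [polarCoord_symm_apply, smul_eq_mul]
      rfl
    · refine Measurable.aemeasurable ?_
      exact hm3.comp (f := fun q : ℝ × ℝ => (z, q.2, q.1)) (by fun_prop)
  rw [h1]
  simp_rw [h2]
  rw [lintegral_lintegral_swap]
  · simp_rw [lintegral_halfPlane hE]
    rw [lintegral_const_mul' _ _ ENNReal.ofReal_ne_top, ← mul_assoc]
    have : (3 : ℝ≥0∞) * ENNReal.ofReal (1 / 3) = 1 := by
      rw [show (3 : ℝ≥0∞) = ENNReal.ofReal 3 by simp, ← ENNReal.ofReal_mul (by norm_num)]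
      norm_num
    rw [this, one_mul]
    refine lintegral_congr fun φ => ?_
    have hmeas : MeasurableSet ((fun θ => (θ, φ)) ⁻¹' (spherePoint ⁻¹' E)) :=
      measurable_prodMk_right (continuous_spherePoint.measurable hE)
    rw [colatMeasure, withDensity_apply _ hmeas, ← lintegral_indicator hmeas]
    refine lintegral_congr fun θ => ?_
    by_cases h : spherePoint (θ, φ) ∈ E
    · rw [Set.indicator_of_mem h, Set.indicator_of_mem (by exact h)]; simp
    · rw [Set.indicator_of_notMem h, Set.indicator_of_notMem (by exact h)]; simp
  · have hm4 : Measurable (Function.uncurry fun (p : ℝ × ℝ) (ρ : ℝ) => ENNReal.ofReal ρ *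
        (coneOver E).indicator (1 : EuclideanSpace ℝ (Fin 3) → ℝ≥0∞)
          !₂[ρ * Real.cos p.2, ρ * Real.sin p.2, p.1]) :=
      hm3.comp (f := fun q : (ℝ × ℝ) × ℝ => (q.1.1, q.1.2, q.2)) (by fun_prop)
    exact (hm4.lintegral_prod_right' (ν := volume.restrict (Set.Ioi 0))).aemeasurable

lemma integral_colatMeasure (a : ℝ → ℝ) :
    ∫ θ, a θ ∂colatMeasure = ∫ θ in (0 : ℝ)..Real.pi, Real.sin θ * a θ := by
  rw [colatMeasure, integral_withDensity_eq_integral_toReal_smul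
    (by fun_prop) (Eventually.of_forall fun _ => ENNReal.ofReal_lt_top),
    intervalIntegral.integral_of_le Real.pi_pos.le, ← restrict_Ioo_eq_restrict_Ioc]
  refine setIntegral_congr_fun measurableSet_Ioo fun θ hθ => ?_
  simp only [smul_eq_mul]
  rw [ENNReal.toReal_ofReal (Real.sin_pos_of_mem_Ioo hθ).le]

/-- Integration over the sphere of a function with separated variables. -/
lemma integral_surf_of_separated {f : S2 → ℝ} (hf : Continuous f) {a b : ℝ → ℝ}
    (h : ∀ θ ∈ Set.Ioo 0 Real.pi, ∀ φ ∈ Set.Ioo (-Real.pi) Real.pi,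
      f (spherePoint (θ, φ)) = a θ * b φ) :
    ∫ s, f s ∂surf =
      (∫ θ in (0 : ℝ)..Real.pi, Real.sin θ * a θ) * ∫ φ in (-Real.pi)..Real.pi, b φ := by
  rw [surf_eq_map, integral_map continuous_spherePoint.measurable.aemeasurable
    hf.aestronglyMeasurable]
  have hae : ∀ᵐ p ∂(colatMeasure.prod longMeasure), f (spherePoint p) = a p.1 * b p.2 := by
    have h1 : ∀ᵐ θ ∂colatMeasure, θ ∈ Set.Ioo 0 Real.pi :=
      (withDensity_absolutelyContinuous _ _).ae_le (ae_restrict_mem measurableSet_Ioo)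
    have h2 : ∀ᵐ φ ∂longMeasure, φ ∈ Set.Ioo (-Real.pi) Real.pi :=
      ae_restrict_mem measurableSet_Ioo
    filter_upwards [Measure.quasiMeasurePreserving_fst.ae h1,
      Measure.quasiMeasurePreserving_snd.ae h2] with p hp1 hp2
    exact h p.1 hp1 p.2 hp2
  rw [integral_congr_ae hae, integral_prod_mul, integral_colatMeasure, longMeasure,
    intervalIntegral.integral_of_le (a := -Real.pi) (by linarith [Real.pi_pos]),
    restrict_Ioo_eq_restrict_Ioc]

/-- The action on the sphere of a linear isometry of `ℝ³`; reflections are allowed. -/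
noncomputable def rotS (R : EuclideanSpace ℝ (Fin 3) ≃ₗᵢ[ℝ] EuclideanSpace ℝ (Fin 3)) (s : S2) :
    S2 :=
  ⟨R s, by rw [mem_sphere_zero_iff_norm, R.norm_map, norm_eq_of_mem_sphere]⟩

variable (R : EuclideanSpace ℝ (Fin 3) ≃ₗᵢ[ℝ] EuclideanSpace ℝ (Fin 3))

lemma continuous_rotS : Continuous (rotS R) :=
  Continuous.subtype_mk (R.continuous.comp continuous_subtype_val) _

lemma rotS_rotS_symm (s : S2) : rotS R (rotS R.symm s) = s := by
  ext1; simp [rotS]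

lemma rotS_symm_rotS (s : S2) : rotS R.symm (rotS R s) = s := by
  ext1; simp [rotS]

lemma dotS_rotS (s t : S2) : dotS (rotS R s) (rotS R t) = dotS s t := by
  simp [dotS, rotS]

lemma measurePreserving_rotS : MeasurePreserving (rotS R) surf surf := by
  refine ⟨(continuous_rotS R).measurable, Measure.ext fun E hE => ?_⟩
  have hE' := (continuous_rotS R).measurable hE
  rw [Measure.map_apply (continuous_rotS R).measurable hE, surf_apply hE, surf_apply hE',
    ← R.measurePreserving.measure_preimage (measurableSet_coneOver hE).nullMeasurableSet]
  congr 2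
  ext x
  constructor
  · rintro ⟨r, hr, s, hs, rfl⟩
    exact ⟨r, hr, rotS R s, hs, by simp [rotS]⟩
  · rintro ⟨r, hr, s, hs, h⟩
    refine ⟨r, hr, rotS R.symm s, ?_, ?_⟩
    · rw [Set.mem_preimage, rotS_rotS_symm]; exact hs
    · apply R.injective
      rw [← h]; simp [rotS]

lemma integral_comp_rotS (f : S2 → ℝ) : ∫ s, f (rotS R s) ∂surf = ∫ s, f s ∂surf := by
  let e : S2 ≃ₜ S2 := ⟨⟨rotS R, rotS R.symm, rotS_symm_rotS R, rotS_rotS_symm R⟩,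
    continuous_rotS R, continuous_rotS R.symm⟩
  exact (measurePreserving_rotS R).integral_comp e.measurableEmbedding f

/-- Any two points of the sphere are exchanged by a reflection. -/
lemma exists_rotS_eq (s t : S2) :
    ∃ R : EuclideanSpace ℝ (Fin 3) ≃ₗᵢ[ℝ] EuclideanSpace ℝ (Fin 3), rotS R s = t := by
  refine ⟨(ℝ ∙ ((s : EuclideanSpace ℝ (Fin 3)) - t))ᗮ.reflection, Subtype.ext ?_⟩
  exact Submodule.reflection_sub (by rw [norm_eq_of_mem_sphere, norm_eq_of_mem_sphere])

end SurfaceMeasure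

/-! ### Polynomials on the sphere -/

section PolySpace

/-- The Cartesian coordinate functions on the sphere. -/
def coordS (i : Fin 3) (s : S2) : ℝ := (s : EuclideanSpace ℝ (Fin 3)) i

/-- The functions on the sphere that are affine in the Cartesian coordinates. -/
def affineSpace : Submodule ℝ (S2 → ℝ) := Submodule.span ℝ (insert 1 (Set.range coordS))

/-- The restrictions to the sphere of polynomials of degree at most `d`, as the `d`-th power of the
space of affine functions in the algebra of functions on the sphere. -/
def polySpace (d : ℕ) : Submodule ℝ (S2 → ℝ) := affineSpace ^ d

lemma one_mem_affineSpace : (1 : S2 → ℝ) ∈ affineSpace :=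
  Submodule.subset_span (Set.mem_insert _ _)

lemma coordS_mem_affineSpace (i : Fin 3) : coordS i ∈ affineSpace :=
  Submodule.subset_span (Set.mem_insert_of_mem _ ⟨i, rfl⟩)

lemma mul_mem_polySpace {a b : ℕ} {f g : S2 → ℝ} (hf : f ∈ polySpace a) (hg : g ∈ polySpace b) :
    f * g ∈ polySpace (a + b) := by
  rw [polySpace, pow_add]
  exact Submodule.mul_mem_mul hf hg

lemma one_mem_polySpace (d : ℕ) : (1 : S2 → ℝ) ∈ polySpace d := by
  have h := Submodule.pow_mem_pow affineSpace one_mem_affineSpace d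
  rwa [one_pow] at h

lemma polySpace_mono {a b : ℕ} (h : a ≤ b) : polySpace a ≤ polySpace b := by
  intro f hf
  obtain ⟨c, rfl⟩ := Nat.exists_eq_add_of_le h
  simpa using mul_mem_polySpace hf (one_mem_polySpace c)

lemma coordS_mem_polySpace (i : Fin 3) : coordS i ∈ polySpace 1 := by
  rw [polySpace, pow_one]
  exact coordS_mem_affineSpace i

lemma coordS_pow_mem_polySpace (i : Fin 3) (k : ℕ) : coordS i ^ k ∈ polySpace k :=
  Submodule.pow_mem_pow affineSpace (coordS_mem_affineSpace i) k

lemma const_mem_polySpace (d : ℕ) (c : ℝ) : (fun _ => c : S2 → ℝ) ∈ polySpace d := by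
  have h := (polySpace d).smul_mem c (one_mem_polySpace d)
  convert h using 1
  ext s; simp

lemma polyEval_mem_polySpace {p : MvPolynomial (Fin 3) ℝ} {d : ℕ} (hp : p.totalDegree ≤ d) :
    polyEval p ∈ polySpace d := by
  have h : polyEval p = ∑ e ∈ p.support,
      p.coeff e • (coordS 0 ^ e 0 * coordS 1 ^ e 1 * coordS 2 ^ e 2) := by
    ext s
    rw [polyEval, MvPolynomial.eval_eq']
    simp [Finset.sum_apply, Fin.prod_univ_three, coordS]
  rw [h]
  refine Submodule.sum_mem _ fun e he => Submodule.smul_mem _ _ ?_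
  have hle := (MvPolynomial.le_totalDegree he).trans hp
  rw [Finsupp.sum_fintype _ _ (fun _ => rfl), Fin.sum_univ_three] at hle
  exact polySpace_mono hle (mul_mem_polySpace (mul_mem_polySpace (coordS_pow_mem_polySpace _ _)
    (coordS_pow_mem_polySpace _ _)) (coordS_pow_mem_polySpace _ _))

lemma exists_polyEval_of_mem {d : ℕ} {f : S2 → ℝ} (hf : f ∈ polySpace d) :
    ∃ p : MvPolynomial (Fin 3) ℝ, p.totalDegree ≤ d ∧ f = polyEval p := by
  have haff : ∀ g ∈ affineSpace, ∃ p : MvPolynomial (Fin 3) ℝ, p.totalDegree ≤ 1 ∧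
      g = polyEval p := by
    intro g hg
    induction hg using Submodule.span_induction with
    | mem x hx =>
      rcases hx with rfl | ⟨i, rfl⟩
      · exact ⟨1, by simp, by ext s; simp [polyEval]⟩
      · exact ⟨MvPolynomial.X i, by simp, by ext s; simp [polyEval, coordS]⟩
    | zero => exact ⟨0, by simp, by ext s; simp [polyEval]⟩
    | add x y _ _ hx hy =>
      obtain ⟨p, hp, rfl⟩ := hx
      obtain ⟨q, hq, rfl⟩ := hy
      exact ⟨p + q, (MvPolynomial.totalDegree_add _ _).trans (max_le hp hq),
        by ext s; simp [polyEval]⟩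
    | smul c x _ hx =>
      obtain ⟨p, hp, rfl⟩ := hx
      exact ⟨c • p, (MvPolynomial.totalDegree_smul_le _ _).trans hp, by ext s; simp [polyEval]⟩
  induction hf using Submodule.pow_induction_on_left' with
  | algebraMap r =>
    exact ⟨MvPolynomial.C r, by simp, by ext s; simp [polyEval]⟩
  | add x y i _ _ hx hy =>
    obtain ⟨p, hp, rfl⟩ := hx
    obtain ⟨q, hq, rfl⟩ := hy
    exact ⟨p + q, (MvPolynomial.totalDegree_add _ _).trans (max_le hp hq),
      by ext s; simp [polyEval]⟩
  | mem_mul m hm i x _ hx =>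
    obtain ⟨p, hp, rfl⟩ := hx
    obtain ⟨q, hq, rfl⟩ := haff m hm
    refine ⟨q * p, (MvPolynomial.totalDegree_mul _ _).trans ?_, by ext s; simp [polyEval]⟩
    have : i.succ = 1 + i := by omega
    rw [this]
    exact add_le_add hq hp

lemma continuous_polyEval (p : MvPolynomial (Fin 3) ℝ) : Continuous (polyEval p) :=
  p.continuous_eval.comp (continuous_pi fun i =>
    (PiLp.continuous_apply 2 _ i).comp continuous_subtype_val)

lemma continuous_of_mem_polySpace {d : ℕ} {f : S2 → ℝ} (hf : f ∈ polySpace d) :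
    Continuous f := by
  obtain ⟨p, _, rfl⟩ := exists_polyEval_of_mem hf
  exact continuous_polyEval p

lemma comp_rotS_mem_polySpace (R : EuclideanSpace ℝ (Fin 3) ≃ₗᵢ[ℝ] EuclideanSpace ℝ (Fin 3))
    {d : ℕ} {f : S2 → ℝ} (hf : f ∈ polySpace d) : (fun s => f (rotS R s)) ∈ polySpace d := by
  have haff : ∀ g ∈ affineSpace, (fun s => g (rotS R s)) ∈ affineSpace := by
    intro g hg
    induction hg using Submodule.span_induction with
    | mem x hx =>
      rcases hx with rfl | ⟨i, rfl⟩
      · exact one_mem_affineSpace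
      · have h : (fun s => coordS i (rotS R s)) =
            ∑ k : Fin 3, (R (EuclideanSpace.single k 1)) i • coordS k := by
          ext s
          have hs : (s : EuclideanSpace ℝ (Fin 3)) =
              ∑ k : Fin 3, (s : EuclideanSpace ℝ (Fin 3)) k • EuclideanSpace.single k (1 : ℝ) := by
            ext j
            fin_cases j <;> simp [Fin.sum_univ_three]
          rw [coordS, rotS]
          simp only
          conv_lhs => rw [hs]
          simp [coordS, map_sum, map_smul, mul_comm]
        rw [h]
        exact Submodule.sum_mem _ fun k _ => Submodule.smul_mem _ _ (coordS_mem_affineSpace k)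
    | zero => exact Submodule.zero_mem _
    | add x y _ _ hx hy => exact Submodule.add_mem _ hx hy
    | smul c x _ hx => exact Submodule.smul_mem _ c hx
  induction hf using Submodule.pow_induction_on_left' with
  | algebraMap r => exact const_mem_polySpace 0 r
  | add x y i _ _ hx hy => exact Submodule.add_mem _ hx hy
  | mem_mul m hm i x _ hx =>
    rw [polySpace, pow_succ']
    exact Submodule.mul_mem_mul (haff m hm) hx

lemma coordS_sq_sum (s : S2) : coordS 0 s ^ 2 + coordS 1 s ^ 2 + coordS 2 s ^ 2 = 1 := by
  have h := norm_eq_of_mem_sphere s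
  rw [EuclideanSpace.norm_eq, Real.sqrt_eq_one, Fin.sum_univ_three] at h
  simpa [coordS] using h

/-- A spanning family of `polySpace d` with `(d + 1) ^ 2` members: the relation
`x² = 1 - y² - z²` reduces all monomials to `y^i z^k` with `i + k ≤ d` and `x y^i z^k` with
`i + k < d`; the latter are indexed by the pairs `(d - i, d - k)`. -/
def polyGen (d : ℕ) (q : Fin (d + 1) × Fin (d + 1)) : S2 → ℝ :=
  if (q.1 : ℕ) + q.2 ≤ d then coordS 1 ^ (q.1 : ℕ) * coordS 2 ^ (q.2 : ℕ)
  else coordS 0 * coordS 1 ^ (d - q.1 : ℕ) * coordS 2 ^ (d - q.2 : ℕ)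

lemma mem_span_polyGen_of_even {d i k : ℕ} (h : i + k ≤ d) :
    coordS 1 ^ i * coordS 2 ^ k ∈ Submodule.span ℝ (Set.range (polyGen d)) := by
  refine Submodule.subset_span ⟨(⟨i, by omega⟩, ⟨k, by omega⟩), ?_⟩
  simp [polyGen, h]

lemma mem_span_polyGen_of_odd {d i k : ℕ} (h : i + k < d) :
    coordS 0 * coordS 1 ^ i * coordS 2 ^ k ∈ Submodule.span ℝ (Set.range (polyGen d)) := by
  refine Submodule.subset_span ⟨(⟨d - i, by omega⟩, ⟨d - k, by omega⟩), ?_⟩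
  have h1 : ¬ (d - i + (d - k) ≤ d) := by omega
  have h2 : d - (d - i) = i := by omega
  have h3 : d - (d - k) = k := by omega
  simp only [polyGen, h1, if_false, h2, h3]

lemma polySpace_le_span_polyGen (d : ℕ) :
    polySpace d ≤ Submodule.span ℝ (Set.range (polyGen d)) := by
  induction d with
  | zero =>
    intro f hf
    rw [polySpace, pow_zero] at hf
    obtain ⟨c, rfl⟩ := Submodule.mem_one.1 hf
    rw [Algebra.algebraMap_eq_smul_one]
    refine Submodule.smul_mem _ _ ?_
    have := mem_span_polyGen_of_even (d := 0) (i := 0) (k := 0) le_rfl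
    simpa using this
  | succ d ih =>
    have hx2 : coordS 0 * coordS 0 = 1 - coordS 1 ^ 2 - coordS 2 ^ 2 := by
      ext s
      have := coordS_sq_sum s
      simp only [Pi.mul_apply, Pi.sub_apply, Pi.one_apply, Pi.pow_apply]
      linarith
    rw [polySpace, pow_succ]
    refine (mul_le_mul' (show affineSpace ^ d ≤ _ from ih) le_rfl).trans ?_
    rw [affineSpace, Submodule.span_mul_span, Submodule.span_le]
    rintro _ ⟨_, ⟨⟨⟨i, hi⟩, ⟨k, hk⟩⟩, rfl⟩, g, hg, rfl⟩
    simp only [SetLike.mem_coe]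
    by_cases hle : i + k ≤ d
    · simp only [polyGen, hle, if_true]
      rcases hg with rfl | ⟨c, rfl⟩
      · rw [mul_one]; exact mem_span_polyGen_of_even (by omega)
      · fin_cases c
        · have := mem_span_polyGen_of_odd (d := d + 1) (i := i) (k := k) (by omega)
          convert this using 1
          simp only [Fin.zero_eta]; ring
        · have := mem_span_polyGen_of_even (d := d + 1) (i := i + 1) (k := k) (by omega)
          convert this using 1
          simp only [Fin.mk_one]; ring
        · have := mem_span_polyGen_of_even (d := d + 1) (i := i) (k := k + 1) (by omega)
          convert this using 1
          simp only [Fin.reduceFinMk]; ring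
    · simp only [polyGen, hle, if_false]
      rcases hg with rfl | ⟨c, rfl⟩
      · rw [mul_one]; exact mem_span_polyGen_of_odd (by omega)
      · fin_cases c
        · have h1 := mem_span_polyGen_of_even (d := d + 1) (i := d - i) (k := d - k) (by omega)
          have h2 := mem_span_polyGen_of_even (d := d + 1) (i := d - i + 2) (k := d - k) (by omega)
          have h3 := mem_span_polyGen_of_even (d := d + 1) (i := d - i) (k := d - k + 2) (by omega)
          have := Submodule.sub_mem _ (Submodule.sub_mem _ h1 h2) h3
          convert this using 1
          simp only [Fin.zero_eta]
          rw [mul_right_comm, mul_right_comm (coordS 0), hx2]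
          ring
        · have := mem_span_polyGen_of_odd (d := d + 1) (i := d - i + 1) (k := d - k) (by omega)
          convert this using 1
          simp only [Fin.mk_one]; ring
        · have := mem_span_polyGen_of_odd (d := d + 1) (i := d - i) (k := d - k + 1) (by omega)
          convert this using 1
          simp only [Fin.reduceFinMk]; ring

instance (d : ℕ) : FiniteDimensional ℝ (Submodule.span ℝ (Set.range (polyGen d))) :=
  FiniteDimensional.span_of_finite ℝ (Set.finite_range _)

instance (d : ℕ) : FiniteDimensional ℝ (polySpace d) :=
  Submodule.finiteDimensional_of_le (polySpace_le_span_polyGen d)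

lemma finrank_polySpace_le (d : ℕ) : Module.finrank ℝ (polySpace d) ≤ (d + 1) ^ 2 := by
  refine (Submodule.finrank_mono (polySpace_le_span_polyGen d)).trans ?_
  refine (finrank_range_le_card (R := ℝ) (polyGen d)).trans ?_
  simp [pow_two]

end PolySpace

/-! ### Spherical harmonics: polynomiality and orthonormality -/

section SphHarm

/-- The dependence of the real spherical harmonics on the longitude. -/
noncomputable def azimuth (m : ℤ) (φ : ℝ) : ℝ :=
  if 0 < m then Real.sqrt 2 * Real.cos ((m.natAbs : ℝ) * φ)
  else if m = 0 then 1
  else Real.sqrt 2 * Real.sin ((m.natAbs : ℝ) * φ)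

lemma sphHarm_eq (l : ℕ) (m : ℤ) (s : S2) :
    sphHarm l m s =
      normFactor l m.natAbs * assocLegendre l m.natAbs (coordS 2 s) * azimuth m (longitude s) := by
  unfold sphHarm azimuth
  split_ifs with h1 h2
  · simp only [coordS]; ring
  · subst h2; simp [assocLegendre, coordS]
  · simp only [coordS]; ring

/-- The point `x + iy` of the complex plane below a point of the sphere. -/
noncomputable def planePoint (s : S2) : ℂ := ⟨coordS 0 s, coordS 1 s⟩

lemma planePoint_pow_mem (k : ℕ) :
    (fun s => (planePoint s ^ k).re) ∈ polySpace k ∧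
      (fun s => (planePoint s ^ k).im) ∈ polySpace k := by
  induction k with
  | zero =>
    simp only [pow_zero, Complex.one_re, Complex.one_im]
    exact ⟨const_mem_polySpace 0 1, const_mem_polySpace 0 0⟩
  | succ k ih =>
    have hre : (fun s => (planePoint s ^ (k + 1)).re) =
        (fun s => (planePoint s ^ k).re) * coordS 0 -
          (fun s => (planePoint s ^ k).im) * coordS 1 := by
      ext s; simp [pow_succ, planePoint]
    have him : (fun s => (planePoint s ^ (k + 1)).im) =
        (fun s => (planePoint s ^ k).re) * coordS 1 +
          (fun s => (planePoint s ^ k).im) * coordS 0 := by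
      ext s; simp [pow_succ, planePoint]
    rw [hre, him]
    exact ⟨Submodule.sub_mem _ (mul_mem_polySpace ih.1 (coordS_mem_polySpace 0))
        (mul_mem_polySpace ih.2 (coordS_mem_polySpace 1)),
      Submodule.add_mem _ (mul_mem_polySpace ih.1 (coordS_mem_polySpace 1))
        (mul_mem_polySpace ih.2 (coordS_mem_polySpace 0))⟩

lemma planePoint_pow_eq (k : ℕ) (s : S2) :
    (planePoint s ^ k).re = Real.sqrt (1 - coordS 2 s ^ 2) ^ k * Real.cos (k * longitude s) ∧
    (planePoint s ^ k).im = Real.sqrt (1 - coordS 2 s ^ 2) ^ k * Real.sin (k * longitude s) := by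
  have hn : ‖planePoint s‖ = Real.sqrt (1 - coordS 2 s ^ 2) := by
    rw [Complex.norm_def, Complex.normSq_apply]
    congr 1
    have := coordS_sq_sum s
    simp only [planePoint]
    linarith
  have harg : (planePoint s).arg = longitude s := rfl
  have h : planePoint s ^ k = ((Real.sqrt (1 - coordS 2 s ^ 2) ^ k : ℝ) : ℂ) *
      (Complex.cos ((k * longitude s : ℝ) : ℂ) + Complex.sin ((k * longitude s : ℝ) : ℂ) *
        Complex.I) := by
    conv_lhs => rw [← Complex.norm_mul_cos_add_sin_mul_I (planePoint s), hn, harg]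
    rw [mul_pow, Complex.cos_add_sin_mul_I_pow]
    push_cast
    rfl
  rw [h, ← Complex.ofReal_cos, ← Complex.ofReal_sin, Complex.re_ofReal_mul, Complex.im_ofReal_mul]
  simp only [Complex.add_re, Complex.add_im, Complex.ofReal_re, Complex.ofReal_im, Complex.mul_re,
    Complex.mul_im, Complex.I_re, Complex.I_im]
  constructor <;> ring

lemma eval_coordS_mem_polySpace (p : Polynomial ℝ) {d : ℕ} (hp : p.natDegree ≤ d) :
    (fun s => p.eval (coordS 2 s)) ∈ polySpace d := by
  have h : (fun s => p.eval (coordS 2 s)) =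
      ∑ i ∈ Finset.range (d + 1), p.coeff i • coordS 2 ^ i := by
    ext s
    rw [Polynomial.eval_eq_sum_range' (Nat.lt_succ_of_le hp)]
    simp [Finset.sum_apply]
  rw [h]
  refine Submodule.sum_mem _ fun i hi => Submodule.smul_mem _ _ ?_
  exact polySpace_mono (Nat.lt_succ_iff.1 (Finset.mem_range.1 hi)) (coordS_pow_mem_polySpace 2 i)

lemma sphHarm_mem_polySpace {l : ℕ} {m : ℤ} (hm : m.natAbs ≤ l) : sphHarm l m ∈ polySpace l := by
  set k := m.natAbs with hk
  have hq := eval_coordS_mem_polySpace _ (natDegree_iterate_derivative_legendre_le l k)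
  have hl : l - k + k = l := by omega
  have key : ∀ (c : ℝ) (g : S2 → ℝ), g ∈ polySpace k →
      (fun s => c * ((Polynomial.derivative^[k] (legendre l)).eval (coordS 2 s) * g s)) ∈
        polySpace l := by
    intro c g hg
    have h := (polySpace _).smul_mem c (mul_mem_polySpace hq hg)
    rw [hl] at h
    exact h
  rcases lt_trichotomy m 0 with h | h | h
  · convert key (Real.sqrt 2 * normFactor l k * (-1) ^ k) _ (planePoint_pow_mem k).2 using 1
    ext s
    rw [(planePoint_pow_eq k s).2]
    simp only [sphHarm, if_neg h.not_gt, if_neg h.ne, assocLegendre, coordS, ← hk]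
    ring
  · subst h
    convert key (normFactor l 0) _ (one_mem_polySpace _) using 1
    ext s
    simp [sphHarm, coordS, hk]
  · convert key (Real.sqrt 2 * normFactor l k * (-1) ^ k) _ (planePoint_pow_mem k).1 using 1
    ext s
    rw [(planePoint_pow_eq k s).1]
    simp only [sphHarm, if_pos h, assocLegendre, coordS, ← hk]
    ring

lemma natAbs_le_of_mIndex {l : ℕ} (m : MIndex l) : (m : ℤ).natAbs ≤ l := by
  have := Finset.mem_Icc.1 m.2
  omega

lemma sphHarm_mem (l : ℕ) (m : MIndex l) : sphHarm l m ∈ polySpace l :=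
  sphHarm_mem_polySpace (natAbs_le_of_mIndex m)

lemma continuous_sphHarm (l : ℕ) (m : MIndex l) : Continuous (sphHarm l m) :=
  continuous_of_mem_polySpace (sphHarm_mem l m)

lemma integral_cos_int_mul (n : ℤ) :
    ∫ φ in (-Real.pi)..Real.pi, Real.cos ((n : ℝ) * φ) = if n = 0 then 2 * Real.pi else 0 := by
  split_ifs with h
  · subst h; simp; ring
  · have hn : (n : ℝ) ≠ 0 := by exact_mod_cast h
    rw [intervalIntegral.integral_comp_mul_left _ hn, integral_cos]
    simp

lemma integral_sin_int_mul (n : ℤ) :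
    ∫ φ in (-Real.pi)..Real.pi, Real.sin ((n : ℝ) * φ) = 0 := by
  by_cases h : n = 0
  · subst h; simp
  · have hn : (n : ℝ) ≠ 0 := by exact_mod_cast h
    rw [intervalIntegral.integral_comp_mul_left _ hn, integral_sin]
    simp

lemma integral_azimuth (m m' : ℤ) :
    ∫ φ in (-Real.pi)..Real.pi, azimuth m φ * azimuth m' φ =
      if m = m' then 2 * Real.pi else 0 := by
  have hs : Real.sqrt 2 * Real.sqrt 2 = 2 := Real.mul_self_sqrt (by norm_num)
  have ic : ∀ n : ℤ, IntervalIntegrable (fun φ => Real.cos ((n : ℝ) * φ)) volume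
      (-Real.pi) Real.pi := fun n => (by fun_prop : Continuous _).intervalIntegrable _ _
  have is : ∀ n : ℤ, IntervalIntegrable (fun φ => Real.sin ((n : ℝ) * φ)) volume
      (-Real.pi) Real.pi := fun n => (by fun_prop : Continuous _).intervalIntegrable _ _
  have hcast : ∀ k : ℤ, ((k.natAbs : ℤ) : ℝ) = (k.natAbs : ℝ) := fun k => by simp
  -- product-to-sum formulas for each combination of signs
  have cc : ∀ a b : ℤ, ∫ φ in (-Real.pi)..Real.pi,
      Real.sqrt 2 * Real.cos ((a : ℝ) * φ) * (Real.sqrt 2 * Real.cos ((b : ℝ) * φ)) =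
      (if a - b = 0 then 2 * Real.pi else 0) + if a + b = 0 then 2 * Real.pi else 0 := by
    intro a b
    rw [← integral_cos_int_mul, ← integral_cos_int_mul,
      ← intervalIntegral.integral_add (ic _) (ic _)]
    congr 1; ext φ
    push_cast
    rw [sub_mul, add_mul, Real.cos_sub, Real.cos_add]
    linear_combination (Real.cos (a * φ) * Real.cos (b * φ)) * hs
  have ss : ∀ a b : ℤ, ∫ φ in (-Real.pi)..Real.pi,
      Real.sqrt 2 * Real.sin ((a : ℝ) * φ) * (Real.sqrt 2 * Real.sin ((b : ℝ) * φ)) =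
      (if a - b = 0 then 2 * Real.pi else 0) - if a + b = 0 then 2 * Real.pi else 0 := by
    intro a b
    rw [← integral_cos_int_mul, ← integral_cos_int_mul,
      ← intervalIntegral.integral_sub (ic _) (ic _)]
    congr 1; ext φ
    push_cast
    rw [sub_mul, add_mul, Real.cos_sub, Real.cos_add]
    linear_combination (Real.sin (a * φ) * Real.sin (b * φ)) * hs
  have sc : ∀ a b : ℤ, ∫ φ in (-Real.pi)..Real.pi,
      Real.sqrt 2 * Real.sin ((a : ℝ) * φ) * (Real.sqrt 2 * Real.cos ((b : ℝ) * φ)) = 0 := by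
    intro a b
    have h0 := intervalIntegral.integral_add (is (a - b)) (is (a + b))
    rw [integral_sin_int_mul, integral_sin_int_mul, add_zero] at h0
    rw [← h0]
    congr 1; ext φ
    push_cast
    rw [sub_mul, add_mul, Real.sin_sub, Real.sin_add]
    linear_combination (Real.sin (a * φ) * Real.cos (b * φ)) * hs
  have cs : ∀ a b : ℤ, ∫ φ in (-Real.pi)..Real.pi,
      Real.sqrt 2 * Real.cos ((a : ℝ) * φ) * (Real.sqrt 2 * Real.sin ((b : ℝ) * φ)) = 0 := by
    intro a b
    rw [← sc b a]
    congr 1; ext φ; ring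
  have c1 : ∀ a : ℤ, a ≠ 0 →
      ∫ φ in (-Real.pi)..Real.pi, Real.sqrt 2 * Real.cos ((a : ℝ) * φ) = 0 := by
    intro a ha
    rw [intervalIntegral.integral_const_mul, integral_cos_int_mul, if_neg ha, mul_zero]
  have s1 : ∀ a : ℤ, ∫ φ in (-Real.pi)..Real.pi, Real.sqrt 2 * Real.sin ((a : ℝ) * φ) = 0 := by
    intro a
    rw [intervalIntegral.integral_const_mul, integral_sin_int_mul, mul_zero]
  rcases lt_trichotomy m 0 with h | h | h <;> rcases lt_trichotomy m' 0 with h' | h' | h'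
  · simp only [azimuth, h.not_gt, h.ne, h'.not_gt, h'.ne, if_false, ← hcast, ss]
    rw [if_neg (show ¬ ((m.natAbs : ℤ) + m'.natAbs = 0) by omega), sub_zero]
    exact if_congr (by omega) rfl rfl
  · subst h'
    simp only [azimuth, h.not_gt, h.ne, if_false, lt_irrefl, if_true, mul_one, ← hcast, s1]
  · simp only [azimuth, h.not_gt, h.ne, if_false, h', if_true, ← hcast, sc]
    rw [if_neg (by omega)]
  · subst h
    simp only [azimuth, h'.not_gt, h'.ne, if_false, lt_irrefl, if_true, one_mul, ← hcast, s1]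
    rw [if_neg (by omega)]
  · subst h h'
    simp [azimuth]; ring
  · subst h
    simp only [azimuth, h', if_false, lt_irrefl, if_true, one_mul, ← hcast]
    rw [c1 _ (by omega), if_neg (by omega)]
  · simp only [azimuth, h'.not_gt, h'.ne, if_false, h, if_true, ← hcast, cs]
    rw [if_neg (by omega)]
  · subst h'
    simp only [azimuth, h, if_false, lt_irrefl, if_true, mul_one, ← hcast]
    rw [c1 _ (by omega), if_neg (by omega)]
  · simp only [azimuth, h, h', if_true, ← hcast, cc]
    rw [if_neg (show ¬ ((m.natAbs : ℤ) + m'.natAbs = 0) by omega), add_zero]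
    exact if_congr (by omega) rfl rfl

lemma integral_sin_mul_eval_cos (p : Polynomial ℝ) :
    ∫ θ in (0 : ℝ)..Real.pi, Real.sin θ * p.eval (Real.cos θ) = intPoly p := by
  have h := intervalIntegral.integral_comp_mul_deriv (a := 0) (b := Real.pi)
    (f := Real.cos) (f' := fun θ => -Real.sin θ) (g := fun x => p.eval x)
    (fun x _ => Real.hasDerivAt_cos x) (by fun_prop) p.continuous
  rw [Real.cos_zero, Real.cos_pi, intervalIntegral.integral_symm (-1) 1] at h
  rw [intPoly, ← neg_inj, ← h, ← intervalIntegral.integral_neg]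
  congr 1; ext θ
  simp only [Function.comp]
  ring

lemma longitude_spherePoint {θ φ : ℝ} (hθ : θ ∈ Set.Ioo 0 Real.pi)
    (hφ : φ ∈ Set.Ioo (-Real.pi) Real.pi) : longitude (spherePoint (θ, φ)) = φ := by
  rw [longitude]
  convert Complex.arg_mul_cos_add_sin_mul_I (Real.sin_pos_of_mem_Ioo hθ) ⟨hφ.1, hφ.2.le⟩ using 2
  rw [← Complex.ofReal_cos, ← Complex.ofReal_sin]
  apply Complex.ext <;>
    simp [spherePoint, -Complex.ofReal_cos, -Complex.ofReal_sin]

lemma normFactor_mul_self (l k : ℕ) : normFactor l k * normFactor l k =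
    (2 * (l : ℝ) + 1) / (4 * Real.pi) * (((l - k).factorial : ℝ) / ((l + k).factorial : ℝ)) :=
  Real.mul_self_sqrt (by positivity)

/-- The spherical harmonics are orthonormal in `L²(𝕊²)`. -/
theorem integral_sphHarm_mul (l l' : ℕ) (m : MIndex l) (m' : MIndex l') :
    ∫ s, sphHarm l m s * sphHarm l' m' s ∂surf =
      if l = l' ∧ (m : ℤ) = m' then 1 else 0 := by
  have hc : Continuous fun s => sphHarm l m s * sphHarm l' m' s :=
    (continuous_sphHarm l m).mul (continuous_sphHarm l' m')
  rw [integral_surf_of_separated hc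
    (a := fun θ => normFactor l (m : ℤ).natAbs * assocLegendre l (m : ℤ).natAbs (Real.cos θ) *
      (normFactor l' (m' : ℤ).natAbs * assocLegendre l' (m' : ℤ).natAbs (Real.cos θ)))
    (b := fun φ => azimuth m φ * azimuth m' φ), integral_azimuth]
  · by_cases hm : (m : ℤ) = m'
    · have hml := natAbs_le_of_mIndex m
      have hml' := natAbs_le_of_mIndex m'
      rw [← hm] at hml' ⊢
      set k := (m : ℤ).natAbs
      have hcongr : ∫ θ in (0 : ℝ)..Real.pi, Real.sin θ *
          (normFactor l k * assocLegendre l k (Real.cos θ) *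
            (normFactor l' k * assocLegendre l' k (Real.cos θ))) =
          normFactor l k * normFactor l' k * ∫ θ in (0 : ℝ)..Real.pi, Real.sin θ *
            ((1 - Polynomial.X ^ 2) ^ k * Polynomial.derivative^[k] (legendre l) *
              Polynomial.derivative^[k] (legendre l')).eval (Real.cos θ) := by
        rw [← intervalIntegral.integral_const_mul]
        congr 1; ext θ
        have h1 : Real.sqrt (1 - Real.cos θ ^ 2) ^ k * Real.sqrt (1 - Real.cos θ ^ 2) ^ k =
            (1 - Real.cos θ ^ 2) ^ k := by
          rw [← mul_pow, Real.mul_self_sqrt (by nlinarith [Real.cos_sq_le_one θ])]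
        have h2 : ((-1 : ℝ) ^ k) * (-1) ^ k = 1 := by rw [← mul_pow]; simp
        simp only [assocLegendre, Polynomial.eval_mul, Polynomial.eval_pow, Polynomial.eval_sub,
          Polynomial.eval_one, Polynomial.eval_X]
        rw [← h1]
        linear_combination (Real.sin θ * normFactor l k * normFactor l' k *
          Real.sqrt (1 - Real.cos θ ^ 2) ^ k * Real.sqrt (1 - Real.cos θ ^ 2) ^ k *
          (Polynomial.derivative^[k] (legendre l)).eval (Real.cos θ) *
          (Polynomial.derivative^[k] (legendre l')).eval (Real.cos θ)) * h2
      rw [hcongr, integral_sin_mul_eval_cos, intPoly_assoc hml hml', if_pos rfl]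
      by_cases hll : l = l'
      · subst hll
        rw [if_pos rfl, if_pos ⟨rfl, rfl⟩, normFactor_mul_self]
        have : ((l - k).factorial : ℝ) ≠ 0 := by positivity
        have : ((l + k).factorial : ℝ) ≠ 0 := by positivity
        have := Real.pi_ne_zero
        field_simp
        ring
      · rw [if_neg hll, if_neg (fun h => hll h.1)]; simp
    · rw [if_neg hm, if_neg (fun h => hm h.2), mul_zero]
  · intro θ hθ φ hφ
    have h2 : coordS 2 (spherePoint (θ, φ)) = Real.cos θ := rfl
    rw [sphHarm_eq, sphHarm_eq, longitude_spherePoint hθ hφ, h2]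
    ring

end SphHarm

/-! ### Completeness of the spherical harmonics among polynomials; the addition theorem -/

section AdditionTheorem

/-- The spherical harmonics as a single family. -/
noncomputable def harm (i : Σ ℓ : ℕ, MIndex ℓ) : S2 → ℝ := sphHarm i.1 i.2

/-- The indices of the spherical harmonics of degree less than `N`. -/
noncomputable def harmIdx (N : ℕ) : Finset (Σ ℓ : ℕ, MIndex ℓ) :=
  (Finset.range N).sigma fun _ => Finset.univ

lemma mem_harmIdx {N : ℕ} {i : Σ ℓ : ℕ, MIndex ℓ} : i ∈ harmIdx N ↔ i.1 < N := by
  simp [harmIdx]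

lemma sum_harmIdx {M : Type*} [AddCommMonoid M] (N : ℕ) (g : (Σ ℓ : ℕ, MIndex ℓ) → M) :
    ∑ i ∈ harmIdx N, g i = ∑ l ∈ Finset.range N, ∑ m : MIndex l, g ⟨l, m⟩ := by
  rw [harmIdx, Finset.sum_sigma]

lemma card_harmIdx (N : ℕ) : (harmIdx N).card = N ^ 2 := by
  induction N with
  | zero => simp [harmIdx]
  | succ N ih =>
    rw [harmIdx, Finset.card_sigma] at ih ⊢
    rw [Finset.sum_range_succ, ih, Finset.card_univ, Fintype.card_coe, Int.card_Icc]
    have : ((N : ℤ) + 1 - -(N : ℤ)).toNat = 2 * N + 1 := by omega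
    rw [this]; ring

lemma continuous_harm (i : Σ ℓ : ℕ, MIndex ℓ) : Continuous (harm i) := continuous_sphHarm _ _

lemma integrable_surf {f : S2 → ℝ} (hf : Continuous f) : Integrable f surf :=
  hf.integrable_of_hasCompactSupport (HasCompactSupport.of_compactSpace f)

lemma integral_harm_mul (i j : Σ ℓ : ℕ, MIndex ℓ) :
    ∫ s, harm i s * harm j s ∂surf = if i = j then 1 else 0 := by
  obtain ⟨l, m⟩ := i
  obtain ⟨l', m'⟩ := j
  rw [harm, harm, integral_sphHarm_mul]
  refine if_congr ⟨?_, ?_⟩ rfl rfl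
  · rintro ⟨h1, h2⟩
    simp only at h1 h2
    subst h1
    rw [Subtype.ext h2]
  · intro h
    cases h
    exact ⟨rfl, rfl⟩

lemma integral_sum_harm_mul (s : Finset (Σ ℓ : ℕ, MIndex ℓ)) (c : (Σ ℓ : ℕ, MIndex ℓ) → ℝ)
    (j : Σ ℓ : ℕ, MIndex ℓ) :
    ∫ t, (∑ i ∈ s, c i * harm i t) * harm j t ∂surf = if j ∈ s then c j else 0 := by
  simp_rw [Finset.sum_mul, mul_assoc]
  rw [integral_finsetSum]
  · simp_rw [integral_const_mul, integral_harm_mul]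
    simp
  · intro i _
    exact integrable_surf (continuous_const.mul ((continuous_harm i).mul (continuous_harm j)))

/-- Parseval's identity for finite expansions in spherical harmonics. -/
lemma integral_sum_harm_sq (s : Finset (Σ ℓ : ℕ, MIndex ℓ)) (c : (Σ ℓ : ℕ, MIndex ℓ) → ℝ) :
    ∫ t, (∑ i ∈ s, c i * harm i t) ^ 2 ∂surf = ∑ i ∈ s, c i ^ 2 := by
  have h : ∀ t, (∑ i ∈ s, c i * harm i t) ^ 2 =
      ∑ j ∈ s, c j * ((∑ i ∈ s, c i * harm i t) * harm j t) := by
    intro t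
    rw [pow_two, Finset.mul_sum]
    exact Finset.sum_congr rfl fun j _ => by ring
  simp_rw [h]
  rw [integral_finsetSum]
  · simp_rw [integral_const_mul, integral_sum_harm_mul]
    exact Finset.sum_congr rfl fun j hj => by rw [if_pos hj]; ring
  · intro j _
    refine integrable_surf (continuous_const.mul (Continuous.mul ?_ (continuous_harm j)))
    exact continuous_finsetSum _ fun i _ => continuous_const.mul (continuous_harm i)

lemma harm_mem_polySpace {N : ℕ} {i : Σ ℓ : ℕ, MIndex ℓ} (hi : i.1 ≤ N) :
    harm i ∈ polySpace N :=
  polySpace_mono hi (sphHarm_mem i.1 i.2)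

lemma sum_harm_mem_polySpace (N : ℕ) (c : (Σ ℓ : ℕ, MIndex ℓ) → ℝ) :
    (fun t => ∑ i ∈ harmIdx (N + 1), c i * harm i t) ∈ polySpace N := by
  have h : (fun t => ∑ i ∈ harmIdx (N + 1), c i * harm i t) =
      ∑ i ∈ harmIdx (N + 1), c i • harm i := by
    ext t; simp [Finset.sum_apply]
  rw [h]
  exact Submodule.sum_mem _ fun i hi => Submodule.smul_mem _ _
    (harm_mem_polySpace (Nat.lt_succ_iff.1 (mem_harmIdx.1 hi)))

/-- The spherical harmonics of degree at most `N` are `(N + 1) ^ 2` independent elements of a space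
of at most this dimension. -/
lemma polySpace_eq_span (N : ℕ) :
    Submodule.span ℝ (Set.range fun i : harmIdx (N + 1) => harm i) = polySpace N := by
  have hli : LinearIndependent ℝ fun i : harmIdx (N + 1) => harm i := by
    rw [Fintype.linearIndependent_iff]
    intro g hg j
    let c : (Σ ℓ : ℕ, MIndex ℓ) → ℝ := fun i => if h : i ∈ harmIdx (N + 1) then g ⟨i, h⟩ else 0
    have h0 : ∀ t, ∑ i ∈ harmIdx (N + 1), c i * harm i t = 0 := by
      intro t
      rw [← Finset.sum_coe_sort]
      have := congrFun hg t
      simp only [Finset.sum_apply, Pi.smul_apply, smul_eq_mul, Pi.zero_apply] at this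
      rw [← this]
      exact Finset.sum_congr rfl fun i _ => by simp [c]
    have h1 := integral_sum_harm_mul (harmIdx (N + 1)) c j
    simp_rw [h0] at h1
    rw [if_pos j.2] at h1
    simpa [c] using h1.symm
  refine Submodule.eq_of_le_of_finrank_le ?_ ?_
  · rw [Submodule.span_le]
    rintro _ ⟨i, rfl⟩
    exact harm_mem_polySpace (Nat.lt_succ_iff.1 (mem_harmIdx.1 i.2))
  · rw [finrank_span_eq_card hli, Fintype.card_coe, card_harmIdx]
    exact finrank_polySpace_le N

/-- A polynomial of degree at most `N` on the sphere is the sum of its expansion in spherical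
harmonics of degree at most `N`. -/
theorem eq_sum_harm_of_mem {N : ℕ} {f : S2 → ℝ} (hf : f ∈ polySpace N) (t : S2) :
    f t = ∑ i ∈ harmIdx (N + 1), (∫ s, f s * harm i s ∂surf) * harm i t := by
  rw [← polySpace_eq_span, Submodule.mem_span_range_iff_exists_fun] at hf
  obtain ⟨g, hg⟩ := hf
  let c : (Σ ℓ : ℕ, MIndex ℓ) → ℝ := fun i => if h : i ∈ harmIdx (N + 1) then g ⟨i, h⟩ else 0
  have h0 : ∀ t, f t = ∑ i ∈ harmIdx (N + 1), c i * harm i t := by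
    intro t
    rw [← Finset.sum_coe_sort, ← hg]
    simp only [Finset.sum_apply, Pi.smul_apply, smul_eq_mul]
    exact Finset.sum_congr rfl fun i _ => by simp [c]
  have h1 : ∀ i ∈ harmIdx (N + 1), ∫ s, f s * harm i s ∂surf = c i := by
    intro i hi
    simp_rw [h0]
    rw [integral_sum_harm_mul, if_pos hi]
  rw [h0]
  exact Finset.sum_congr rfl fun i hi => by rw [h1 i hi]

/-- Polynomials of degree less than `l` are orthogonal to the harmonics of degree `l`. -/
lemma integral_mul_harm_of_lt {N : ℕ} {f : S2 → ℝ} (hf : f ∈ polySpace N)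
    {i : Σ ℓ : ℕ, MIndex ℓ} (hi : N < i.1) : ∫ s, f s * harm i s ∂surf = 0 := by
  have h := integral_sum_harm_mul (harmIdx (N + 1)) (fun j => ∫ s, f s * harm j s ∂surf) i
  rw [if_neg (by rw [mem_harmIdx]; omega)] at h
  rw [← h]
  congr 1; ext s
  rw [← eq_sum_harm_of_mem hf s]

/-- The reproducing kernel of the polynomials on the sphere of degree less than `N`. -/
noncomputable def harmKernel (N : ℕ) (s t : S2) : ℝ := ∑ i ∈ harmIdx N, harm i s * harm i t

/-- The reproducing kernel is invariant under isometries, because the space of polynomials and the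
surface measure are. -/
lemma harmKernel_rotS (R : EuclideanSpace ℝ (Fin 3) ≃ₗᵢ[ℝ] EuclideanSpace ℝ (Fin 3)) (N : ℕ)
    (s t : S2) : harmKernel N (rotS R s) t = harmKernel N s (rotS R.symm t) := by
  rcases N with _ | N
  · rw [harmKernel, harmKernel, sum_harmIdx, sum_harmIdx]; simp
  have h1 : (fun s => harmKernel (N + 1) (rotS R s) t) ∈ polySpace N := by
    have := comp_rotS_mem_polySpace R (sum_harm_mem_polySpace N fun i => harm i t)
    convert this using 1
    ext s
    exact Finset.sum_congr rfl fun i _ => mul_comm _ _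
  rw [eq_sum_harm_of_mem h1]
  refine Finset.sum_congr rfl fun i hi => ?_
  rw [mul_comm]
  congr 1
  have h2 := comp_rotS_mem_polySpace R.symm
    (harm_mem_polySpace (N := N) (Nat.lt_succ_iff.1 (mem_harmIdx.1 hi)))
  rw [eq_sum_harm_of_mem h2 t]
  have h3 := integral_comp_rotS R fun s => harmKernel (N + 1) s t * harm i (rotS R.symm s)
  simp only [rotS_symm_rotS] at h3
  rw [h3]
  simp only [harmKernel, Finset.sum_mul]
  rw [integral_finsetSum]
  · refine Finset.sum_congr rfl fun j _ => ?_
    rw [← integral_mul_const]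
    congr 1; ext s; ring
  · intro j _
    exact integrable_surf (((continuous_harm j).mul continuous_const).mul
      ((continuous_harm i).comp (continuous_rotS _)))

/-- The zonal sum `∑_m Y_{ℓm}(s) Y_{ℓm}(t)`. -/
noncomputable def zonal (l : ℕ) (s t : S2) : ℝ := ∑ m : MIndex l, sphHarm l m s * sphHarm l m t

lemma zonal_eq_sub (l : ℕ) (s t : S2) :
    zonal l s t = harmKernel (l + 1) s t - harmKernel l s t := by
  rw [harmKernel, harmKernel, sum_harmIdx, sum_harmIdx, Finset.sum_range_succ]
  simp [zonal, harm]

lemma zonal_rotS (R : EuclideanSpace ℝ (Fin 3) ≃ₗᵢ[ℝ] EuclideanSpace ℝ (Fin 3)) (l : ℕ)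
    (s t : S2) : zonal l (rotS R s) (rotS R t) = zonal l s t := by
  rw [zonal_eq_sub, zonal_eq_sub, harmKernel_rotS, harmKernel_rotS, rotS_symm_rotS]

/-- The point `(0, 0, 1)`. -/
noncomputable def northPole : S2 := ⟨EuclideanSpace.single 2 1, by simp⟩

lemma coordS_two_northPole : coordS 2 northPole = 1 := by simp [coordS, northPole]

lemma dotS_northPole (s : S2) : dotS s northPole = coordS 2 s := by
  simp [dotS, northPole, coordS, EuclideanSpace.inner_single_right]

lemma sphHarm_northPole {l : ℕ} {m : ℤ} (hm : m ≠ 0) : sphHarm l m northPole = 0 := by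
  have h : assocLegendre l m.natAbs 1 = 0 := by
    have : m.natAbs ≠ 0 := by omega
    simp [assocLegendre, this]
  rw [sphHarm_eq, coordS_two_northPole, h]
  ring

lemma zonal_northPole (l : ℕ) (s : S2) :
    zonal l s northPole = (2 * (l : ℝ) + 1) / (4 * Real.pi) * (legendre l).eval (coordS 2 s) := by
  rw [zonal, Finset.sum_eq_single (⟨0, by simp⟩ : MIndex l)]
  · have h1 : sphHarm l 0 northPole = normFactor l 0 := by
      have := coordS_two_northPole
      rw [coordS] at this
      simp [sphHarm, this, eval_one_legendre]
    have h2 : sphHarm l 0 s = normFactor l 0 * (legendre l).eval (coordS 2 s) := by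
      simp [sphHarm, coordS]
    have h3 := normFactor_mul_self l 0
    have : (l.factorial : ℝ) ≠ 0 := by positivity
    rw [Nat.sub_zero, Nat.add_zero, div_self this, mul_one] at h3
    simp only
    rw [h1, h2, ← h3]
    ring
  · intro m _ hm
    rw [sphHarm_northPole, mul_zero]
    intro h
    exact hm (Subtype.ext h)
  · intro h
    exact absurd (Finset.mem_univ _) h

/-- The addition theorem for spherical harmonics. -/
theorem zonal_eq_legendre (l : ℕ) (s t : S2) :
    zonal l s t = (2 * (l : ℝ) + 1) / (4 * Real.pi) * (legendre l).eval (dotS s t) := by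
  obtain ⟨R, hR⟩ := exists_rotS_eq t northPole
  rw [← zonal_rotS R, hR, zonal_northPole, ← dotS_northPole, ← hR, dotS_rotS]

lemma zonal_self (l : ℕ) (s : S2) : zonal l s s = (2 * (l : ℝ) + 1) / (4 * Real.pi) := by
  have h : dotS s s = 1 := by
    rw [dotS, real_inner_self_eq_norm_sq, norm_eq_of_mem_sphere, one_pow]
  rw [zonal_eq_legendre, h, eval_one_legendre, mul_one]

end AdditionTheorem

/-! ### Mean square limits of Gaussian series -/

section GaussianSeries

lemma inner_toLp {α : Type*} [MeasurableSpace α] {μ : Measure α} {f g : α → ℝ}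
    (hf : MemLp f 2 μ) (hg : MemLp g 2 μ) :
    inner ℝ (hf.toLp f) (hg.toLp g) = ∫ x, f x * g x ∂μ := by
  rw [L2.inner_def]
  refine integral_congr_ae ?_
  filter_upwards [hf.coeFn_toLp, hg.coeFn_toLp] with x h1 h2
  rw [h1, h2]
  simp [mul_comm]

lemma toLp_finsetSum_mul {α ι : Type*} [MeasurableSpace α] {μ : Measure α} {f : ι → α → ℝ}
    (hf : ∀ i, MemLp (f i) 2 μ) (s : Finset ι) (a : ι → ℝ) :
    (memLp_finsetSum s fun i _ => (hf i).const_mul (a i)).toLp (fun x => ∑ i ∈ s, a i * f i x) =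
      ∑ i ∈ s, a i • (hf i).toLp (f i) := by
  classical
  induction s using Finset.induction_on with
  | empty => simp only [Finset.sum_empty]; rfl
  | insert j s hj ih =>
    rw [Finset.sum_insert hj, ← ih, ← MemLp.toLp_const_smul, ← MemLp.toLp_add]
    refine MemLp.toLp_congr _ _ (Eventually.of_forall fun x => ?_)
    simp [Finset.sum_insert hj]

variable {Ω ι κ : Type*} [MeasurableSpace Ω] {P : Measure Ω}
  {y : ι → Ω → ℝ} {F : κ → Finset ι} {l : Filter κ}

lemma IsIIDStdNormal.memLp (hy : IsIIDStdNormal P y) (i : ι) : MemLp (y i) 2 P := by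
  have h := memLp_id_gaussianReal (μ := 0) (v := 1) 2
  rw [← (hy.law i).map_eq] at h
  exact (memLp_map_measure_iff h.1 (hy.law i).aemeasurable).1 h

lemma IsIIDStdNormal.integral_mul [IsProbabilityMeasure P] [DecidableEq ι]
    (hy : IsIIDStdNormal P y) (i j : ι) :
    ∫ ω, y i ω * y j ω ∂P = if i = j then 1 else 0 := by
  have h0 : ∀ i, ∫ ω, y i ω ∂P = 0 := fun i => by
    rw [(hy.law i).integral_eq]; exact integral_id_gaussianReal
  split_ifs with h
  · subst h
    have h1 := variance_eq_sub (hy.memLp i)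
    rw [(hy.law i).variance_eq, variance_id_gaussianReal, h0] at h1
    simp only [Pi.pow_apply] at h1
    simp_rw [← pow_two]
    norm_num at h1
    exact h1.symm
  · rw [(hy.indep.indepFun h).integral_fun_mul_eq_mul_integral (hy.memLp i).1 (hy.memLp j).1, h0,
      zero_mul]

/-- The elements of `L²` defined by independent standard normal variables. -/
noncomputable def IsIIDStdNormal.vec (hy : IsIIDStdNormal P y) (i : ι) : Lp ℝ 2 P :=
  (hy.memLp i).toLp (y i)

lemma IsIIDStdNormal.orthonormal_vec [IsProbabilityMeasure P] (hy : IsIIDStdNormal P y) :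
    Orthonormal ℝ hy.vec := by
  classical
  rw [orthonormal_iff_ite]
  intro i j
  rw [IsIIDStdNormal.vec, IsIIDStdNormal.vec, inner_toLp, hy.integral_mul]

/-- `X` is the limit in mean square along `l` of the partial sums `∑_{i ∈ F n} a_i y_i`. -/
def IsMeanSquareLimit (P : Measure Ω) (y : ι → Ω → ℝ) (F : κ → Finset ι) (l : Filter κ)
    (a : ι → ℝ) (X : Ω → ℝ) : Prop :=
  AEStronglyMeasurable X P ∧
    Tendsto (fun n => eLpNorm (fun ω => X ω - ∑ i ∈ F n, a i * y i ω) 2 P) l (𝓝 0)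

lemma memLp_sum (hy : IsIIDStdNormal P y) (s : Finset ι) (a : ι → ℝ) :
    MemLp (fun ω => ∑ i ∈ s, a i * y i ω) 2 P :=
  memLp_finsetSum s fun i _ => (hy.memLp i).const_mul (a i)

lemma toLp_sum (hy : IsIIDStdNormal P y) (s : Finset ι) (a : ι → ℝ) :
    (memLp_sum hy s a).toLp _ = ∑ i ∈ s, a i • hy.vec i :=
  toLp_finsetSum_mul hy.memLp s a

lemma IsMeanSquareLimit.finset_sum {T : Type*} {a : T → ι → ℝ} {X : T → Ω → ℝ}
    (hy : IsIIDStdNormal P y) (h : ∀ t, IsMeanSquareLimit P y F l (a t) (X t)) (s : Finset T)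
    (c : T → ℝ) :
    IsMeanSquareLimit P y F l (fun i => ∑ t ∈ s, c t * a t i) fun ω => ∑ t ∈ s, c t * X t ω := by
  classical
  induction s using Finset.induction_on with
  | empty =>
    refine ⟨by simpa using aestronglyMeasurable_const, ?_⟩
    simpa using tendsto_const_nhds
  | insert t s ht ih =>
    simp only [Finset.sum_insert ht]
    refine ⟨((h t).1.const_mul _).add ih.1, ?_⟩
    have h1 : Tendsto (fun n =>
        ENNReal.ofReal |c t| * eLpNorm (fun ω => X t ω - ∑ i ∈ F n, a t i * y i ω) 2 P +
        eLpNorm (fun ω => ∑ t ∈ s, c t * X t ω - ∑ i ∈ F n, (∑ t ∈ s, c t * a t i) * y i ω) 2 P)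
        l (𝓝 0) := by
      have := (ENNReal.Tendsto.const_mul (a := ENNReal.ofReal |c t|) (h t).2
        (Or.inr ENNReal.ofReal_ne_top)).add ih.2
      simpa using this
    refine tendsto_of_tendsto_of_tendsto_of_le_of_le tendsto_const_nhds h1 (fun _ => zero_le) ?_
    intro n
    have e : (fun ω => c t * X t ω + ∑ t ∈ s, c t * X t ω -
        ∑ i ∈ F n, (c t * a t i + ∑ t ∈ s, c t * a t i) * y i ω) =
        (c t • fun ω => X t ω - ∑ i ∈ F n, a t i * y i ω) +
          fun ω => ∑ t ∈ s, c t * X t ω - ∑ i ∈ F n, (∑ t ∈ s, c t * a t i) * y i ω := by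
      ext ω
      simp only [Pi.add_apply, Pi.smul_apply, smul_eq_mul, add_mul, Finset.sum_add_distrib, mul_sub,
        Finset.mul_sum, mul_assoc]
      ring
    simp only
    rw [e]
    have m1 := ((h t).1.sub (memLp_sum hy (F n) (a t)).1).const_smul (c t)
    have m2 := ih.1.sub (memLp_sum hy (F n) (fun i => ∑ t ∈ s, c t * a t i)).1
    refine (eLpNorm_add_le m1 m2 (by norm_num)).trans ?_
    rw [eLpNorm_const_smul, Real.enorm_eq_ofReal_abs]
    exact le_rfl

variable [l.NeBot] {a b : ι → ℝ} {X Z : Ω → ℝ}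

lemma IsMeanSquareLimit.memLp (hy : IsIIDStdNormal P y) (h : IsMeanSquareLimit P y F l a X) :
    MemLp X 2 P := by
  obtain ⟨n, hn⟩ := (h.2.eventually (gt_mem_nhds ENNReal.zero_lt_top)).exists
  have h1 : MemLp (fun ω => X ω - ∑ i ∈ F n, a i * y i ω) 2 P :=
    ⟨h.1.sub (memLp_sum hy (F n) a).1, hn⟩
  have h2 := h1.add (memLp_sum hy (F n) a)
  convert h2 using 1
  ext ω; simp

lemma IsMeanSquareLimit.tendsto_toLp (hy : IsIIDStdNormal P y)
    (h : IsMeanSquareLimit P y F l a X) :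
    Tendsto (fun n => ∑ i ∈ F n, a i • hy.vec i) l (𝓝 ((h.memLp hy).toLp X)) := by
  simp_rw [← toLp_sum]
  rw [Lp.tendsto_Lp_iff_tendsto_eLpNorm'']
  refine h.2.congr fun n => ?_
  exact eLpNorm_sub_comm _ _ _ _

/-- The covariance of two Gaussian series is the sum of the products of their coefficients. -/
lemma IsMeanSquareLimit.tendsto_sum_mul [IsProbabilityMeasure P] (hy : IsIIDStdNormal P y)
    (hX : IsMeanSquareLimit P y F l a X) (hZ : IsMeanSquareLimit P y F l b Z) :
    Tendsto (fun n => ∑ i ∈ F n, a i * b i) l (𝓝 (∫ ω, X ω * Z ω ∂P)) := by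
  have h := (hX.tendsto_toLp hy).inner (𝕜 := ℝ) (hZ.tendsto_toLp hy)
  rw [inner_toLp] at h
  refine h.congr fun n => ?_
  rw [hy.orthonormal_vec.inner_sum]
  simp

lemma integral_exp_sum [IsProbabilityMeasure P] (hy : IsIIDStdNormal P y) (s : Finset ι)
    (a : ι → ℝ) :
    ∫ ω, Complex.exp (((∑ i ∈ s, a i * y i ω : ℝ) : ℂ) * Complex.I) ∂P =
      Complex.exp (-((∑ i ∈ s, a i * a i : ℝ) : ℂ) / 2) := by
  have hm : ∀ i ∈ s, AEMeasurable (fun ω => a i * y i ω) P :=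
    fun i _ => (hy.law i).aemeasurable.const_mul (a i)
  have hind : iIndepFun (s.restrict fun i ω => a i * y i ω) P :=
    (hy.indep.comp (fun i x => a i * x) fun i => measurable_const_mul (a i)).restrict s
  have h := congrFun (hind.charFun_map_fun_finsetSum_eq_prod hm) 1
  rw [charFun_apply_real, integral_map (Finset.aemeasurable_fun_sum s hm)
    (by fun_prop), Finset.prod_apply] at h
  have h2 : ∀ i ∈ s, charFun (P.map fun ω => a i * y i ω) 1 =
      Complex.exp (-((a i * a i : ℝ) : ℂ) / 2) := by
    intro i _
    rw [(gaussianReal_const_mul (hy.law i) (a i)).map_eq, charFun_gaussianReal]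
    congr 1
    simp
    ring
  rw [Finset.prod_congr rfl h2, ← Complex.exp_sum] at h
  simp only [Complex.ofReal_one, one_mul] at h
  rw [h]
  congr 1
  push_cast
  rw [neg_div, Finset.sum_div, ← Finset.sum_neg_distrib]
  exact Finset.sum_congr rfl fun i _ => by ring

/-- A mean square limit of Gaussian series has a Gaussian characteristic function. -/
lemma IsMeanSquareLimit.integral_exp [IsProbabilityMeasure P] (hy : IsIIDStdNormal P y)
    (hX : IsMeanSquareLimit P y F l a X) :
    ∫ ω, Complex.exp ((X ω : ℂ) * Complex.I) ∂P =
      Complex.exp (-((∫ ω, X ω * X ω ∂P : ℝ) : ℂ) / 2) := by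
  have h1 : Tendsto (fun n => Complex.exp (-((∑ i ∈ F n, a i * a i : ℝ) : ℂ) / 2)) l
      (𝓝 (Complex.exp (-((∫ ω, X ω * X ω ∂P : ℝ) : ℂ) / 2))) := by
    have hc : Continuous fun x : ℝ => Complex.exp (-(x : ℂ) / 2) := by fun_prop
    exact (hc.tendsto _).comp (hX.tendsto_sum_mul hy hX)
  refine tendsto_nhds_unique ?_ h1
  have hint : ∀ Z : Ω → ℝ, AEStronglyMeasurable Z P →
      Integrable (fun ω => Complex.exp ((Z ω : ℂ) * Complex.I)) P := by
    intro Z hZ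
    have hc : Continuous fun x : ℝ => Complex.exp ((x : ℂ) * Complex.I) := by fun_prop
    refine (integrable_const (1 : ℝ)).mono' (hc.comp_aestronglyMeasurable hZ) ?_
    exact Eventually.of_forall fun ω => (Complex.norm_exp_ofReal_mul_I _).le
  -- the map `x ↦ exp (i x)` is `1`-Lipschitz, so convergence in `L¹` suffices
  have hlip : ∀ x y : ℝ, ‖Complex.exp ((x : ℂ) * Complex.I) - Complex.exp ((y : ℂ) * Complex.I)‖ ≤
      ‖y - x‖ := by
    intro x y
    have e : Complex.exp ((x : ℂ) * Complex.I) - Complex.exp ((y : ℂ) * Complex.I) =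
        -(Complex.exp ((x : ℂ) * Complex.I) *
          (Complex.exp (Complex.I * ((y - x : ℝ) : ℂ)) - 1)) := by
      rw [mul_sub, ← Complex.exp_add]
      push_cast
      ring_nf
    rw [e, norm_neg, norm_mul, Complex.norm_exp_ofReal_mul_I, one_mul]
    exact Real.norm_exp_I_mul_ofReal_sub_one_le
  simp_rw [← integral_exp_sum hy]
  rw [tendsto_iff_norm_sub_tendsto_zero]
  have hreal : Tendsto (fun n => (eLpNorm (fun ω => X ω - ∑ i ∈ F n, a i * y i ω) 2 P).toReal) l
      (𝓝 0) := by
    have := (ENNReal.tendsto_toReal ENNReal.zero_ne_top).comp hX.2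
    rwa [ENNReal.toReal_zero] at this
  refine squeeze_zero (fun _ => norm_nonneg _) (fun n => ?_) hreal
  have hn := memLp_sum hy (F n) a
  have hd : MemLp (fun ω => X ω - ∑ i ∈ F n, a i * y i ω) 2 P := (hX.memLp hy).sub hn
  rw [norm_sub_rev, ← integral_sub (hint _ hX.1) (hint _ hn.1)]
  calc ‖∫ ω, (Complex.exp ((X ω : ℂ) * Complex.I) -
          Complex.exp (((∑ i ∈ F n, a i * y i ω : ℝ) : ℂ) * Complex.I)) ∂P‖
      ≤ ∫ ω, ‖X ω - ∑ i ∈ F n, a i * y i ω‖ ∂P := by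
        refine norm_integral_le_of_norm_le (hd.integrable (by norm_num)).norm
          (Eventually.of_forall fun ω => ?_)
        rw [norm_sub_rev (X ω)]
        exact hlip _ _
    _ = (eLpNorm (fun ω => X ω - ∑ i ∈ F n, a i * y i ω) 1 P).toReal := by
        rw [eLpNorm_one_eq_lintegral_enorm, integral_norm_eq_lintegral_enorm hd.1]
    _ ≤ _ := by
        refine ENNReal.toReal_mono hd.2.ne ?_
        exact eLpNorm_le_eLpNorm_of_exponent_le (by norm_num) hd.1

variable {Ω' ι' κ' : Type*} [MeasurableSpace Ω'] {P' : Measure Ω'}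
  {y' : ι' → Ω' → ℝ} {F' : κ' → Finset ι'} {l' : Filter κ'} [l'.NeBot]

lemma integral_linearCombination_mul_self {T : Type*} [Fintype T] {W : T → Ω → ℝ}
    (hW : ∀ t, MemLp (W t) 2 P) {c : T → ℝ} :
    ∫ ω, (∑ t, c t * W t ω) * (∑ t, c t * W t ω) ∂P =
      ∑ s, ∑ t, c s * c t * ∫ ω, W s ω * W t ω ∂P := by
  have hi : ∀ s t : T, Integrable (fun ω => c s * W s ω * (c t * W t ω)) P := fun s t =>
    MemLp.integrable_mul ((hW s).const_mul _) ((hW t).const_mul _)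
  simp_rw [Finset.sum_mul_sum]
  rw [integral_finsetSum _ fun s _ => integrable_finsetSum _ fun t _ => hi s t]
  refine Finset.sum_congr rfl fun s _ => ?_
  rw [integral_finsetSum _ fun t _ => hi s t]
  refine Finset.sum_congr rfl fun t _ => ?_
  rw [← integral_const_mul]
  congr 1; ext ω; ring

/-- Two processes that are pointwise mean square limits of Gaussian series have the same law as soon
as they have the same covariance function. -/
theorem identDistrib_of_isMeanSquareLimit [IsProbabilityMeasure P] [IsProbabilityMeasure P']
    {T : Type*} {a : T → ι → ℝ} {a' : T → ι' → ℝ} {X : Ω → T → ℝ} {X' : Ω' → T → ℝ}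
    (hy : IsIIDStdNormal P y) (hy' : IsIIDStdNormal P' y')
    (hXm : Measurable X) (hXm' : Measurable X')
    (hX : ∀ t, IsMeanSquareLimit P y F l (a t) fun ω => X ω t)
    (hX' : ∀ t, IsMeanSquareLimit P' y' F' l' (a' t) fun ω => X' ω t)
    (hcov : ∀ s t, ∫ ω, X ω s * X ω t ∂P = ∫ ω, X' ω s * X' ω t ∂P') :
    IdentDistrib X X' P P' := by
  classical
  refine ⟨hXm.aemeasurable, hXm'.aemeasurable, ?_⟩
  have hfin : ∀ I : Finset T, P.map (fun ω => I.restrict (X ω)) =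
      P'.map (fun ω => I.restrict (X' ω)) := by
    intro I
    have hr : Measurable (I.restrict : (T → ℝ) → (I → ℝ)) := Finset.measurable_restrict I
    have : IsProbabilityMeasure (P.map (fun ω => I.restrict (X ω))) :=
      Measure.isProbabilityMeasure_map (hr.comp hXm).aemeasurable
    have : IsProbabilityMeasure (P'.map (fun ω => I.restrict (X' ω))) :=
      Measure.isProbabilityMeasure_map (hr.comp hXm').aemeasurable
    refine Measure.ext_of_charFunDual (funext fun L => ?_)
    have hL : ∀ x : T → ℝ, L (I.restrict x) =
        ∑ t : I, L (Pi.single t 1) * x t := by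
      intro x
      conv_lhs => rw [← Finset.univ_sum_single (I.restrict x)]
      rw [map_sum]
      refine Finset.sum_congr rfl fun t _ => ?_
      have : (Pi.single t (I.restrict x t) : I → ℝ) = x t • Pi.single t 1 := by
        rw [← Pi.single_smul]; simp
      rw [this, map_smul, smul_eq_mul, mul_comm]
    have key := IsMeanSquareLimit.integral_exp hy (IsMeanSquareLimit.finset_sum hy
      (fun t : I => hX t) Finset.univ fun t : I => L (Pi.single t 1))
    have key' := IsMeanSquareLimit.integral_exp hy' (IsMeanSquareLimit.finset_sum hy'
      (fun t : I => hX' t) Finset.univ fun t : I => L (Pi.single t 1))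
    have hcm : Continuous fun x : I → ℝ => Complex.exp ((L x : ℂ) * Complex.I) := by fun_prop
    rw [charFunDual_apply, charFunDual_apply,
      integral_map (φ := fun ω => I.restrict (X ω)) (hr.comp hXm).aemeasurable
        hcm.aestronglyMeasurable,
      integral_map (φ := fun ω => I.restrict (X' ω)) (hr.comp hXm').aemeasurable
        hcm.aestronglyMeasurable]
    simp_rw [hL]
    rw [key, key']
    rw [integral_linearCombination_mul_self (fun t : I => (hX t).memLp hy),
      integral_linearCombination_mul_self (fun t : I => (hX' t).memLp hy')]
    simp_rw [hcov]
  have hp : IsProjectiveLimit (P.map X) fun I => P.map (fun ω => I.restrict (X ω)) :=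
    isProjectiveLimit_map (X := fun t ω => X ω t) hXm.aemeasurable
  have hp' : IsProjectiveLimit (P'.map X') fun I => P'.map (fun ω => I.restrict (X' ω)) :=
    isProjectiveLimit_map (X := fun t ω => X' ω t) hXm'.aemeasurable
  have : ∀ I : Finset T, IsFiniteMeasure (P'.map (fun ω => I.restrict (X' ω))) := fun I =>
    inferInstance
  exact IsProjectiveLimit.unique (fun I => (hp I).trans (hfin I)) hp'

end GaussianSeries

/-! ### Parseval families in Hilbert spaces -/

section Hilbert

variable {ι H : Type*} [NormedAddCommGroup H] [InnerProductSpace ℝ H]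

/-- The Cauchy criterion for series that satisfy a Bessel inequality. -/
lemma summable_smul_of_norm_sum_sq_le [CompleteSpace H] {φ : ι → H} {c : ι → ℝ}
    (h : ∀ s : Finset ι, ‖∑ i ∈ s, c i • φ i‖ ^ 2 ≤ ∑ i ∈ s, c i ^ 2)
    (hc : Summable fun i => c i ^ 2) : Summable fun i => c i • φ i := by
  rw [summable_iff_vanishing_norm] at hc ⊢
  intro ε hε
  obtain ⟨s, hs⟩ := hc (ε ^ 2) (by positivity)
  refine ⟨s, fun t ht => ?_⟩
  have h1 := hs t ht
  rw [Real.norm_of_nonneg (Finset.sum_nonneg fun i _ => sq_nonneg _)] at h1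
  exact lt_of_pow_lt_pow_left₀ 2 hε.le ((h t).trans_lt h1)

lemma norm_sum_smul_sq_of_orthonormal {e : ι → H} (he : Orthonormal ℝ e) (c : ι → ℝ)
    (s : Finset ι) : ‖∑ i ∈ s, c i • e i‖ ^ 2 = ∑ i ∈ s, c i ^ 2 := by
  rw [← real_inner_self_eq_norm_sq, he.inner_sum]
  exact Finset.sum_congr rfl fun i _ => by simp [pow_two]

/-- Polarization of the Parseval identity. -/
lemma hasSum_inner_mul_inner {φ : ι → H}
    (h : ∀ f : H, HasSum (fun i => |inner ℝ f (φ i)| ^ 2) (‖f‖ ^ 2)) (f g : H) :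
    HasSum (fun i => inner ℝ f (φ i) * inner ℝ g (φ i)) (inner ℝ f g) := by
  have h1 := ((h (f + g)).sub (h (f - g))).mul_left (1 / 4)
  have e1 : (fun i => inner ℝ f (φ i) * inner ℝ g (φ i)) = fun i =>
      1 / 4 * (|inner ℝ (f + g) (φ i)| ^ 2 - |inner ℝ (f - g) (φ i)| ^ 2) := by
    ext i
    rw [sq_abs, sq_abs, inner_add_left, inner_sub_left]
    ring
  have e2 : inner ℝ f g = 1 / 4 * (‖f + g‖ ^ 2 - ‖f - g‖ ^ 2) := by
    rw [@norm_add_sq_real, @norm_sub_sq_real]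
    ring
  rw [e1, e2]
  exact h1

/-- In a Hilbert space, the Parseval identity implies the reconstruction formula. -/
lemma isParsevalFrame_of_parseval [CompleteSpace H] {φ : ι → H}
    (h : ∀ f : H, HasSum (fun i => |inner ℝ f (φ i)| ^ 2) (‖f‖ ^ 2)) : IsParsevalFrame φ := by
  refine ⟨h, fun f => ?_⟩
  have hb : ∀ s : Finset ι, ‖∑ i ∈ s, inner ℝ f (φ i) • φ i‖ ^ 2 ≤
      ∑ i ∈ s, (inner ℝ f (φ i)) ^ 2 := by
    intro s
    -- test the partial sum against itself and apply the Cauchy–Schwarz and Bessel inequalities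
    set g := ∑ i ∈ s, inner ℝ f (φ i) • φ i with hg
    have h1 : ‖g‖ ^ 2 = ∑ i ∈ s, inner ℝ f (φ i) * inner ℝ g (φ i) := by
      rw [← real_inner_self_eq_norm_sq]
      conv_lhs => rw [hg, inner_sum]
      refine Finset.sum_congr rfl fun i _ => ?_
      rw [real_inner_smul_right]
    have h2 := Finset.sum_mul_sq_le_sq_mul_sq s (fun i => inner ℝ f (φ i)) fun i => inner ℝ g (φ i)
    have h3 : ∑ i ∈ s, (inner ℝ g (φ i)) ^ 2 ≤ ‖g‖ ^ 2 := by
      have := sum_le_hasSum s (fun i _ => sq_nonneg _) (h g)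
      simpa [sq_abs] using this
    rw [← h1] at h2
    by_cases hg0 : ‖g‖ ^ 2 = 0
    · rw [hg0]; exact Finset.sum_nonneg fun i _ => sq_nonneg _
    · have hpos : 0 < ‖g‖ ^ 2 := lt_of_le_of_ne (sq_nonneg _) (Ne.symm hg0)
      have h4 : (‖g‖ ^ 2) * ‖g‖ ^ 2 ≤ (∑ i ∈ s, (inner ℝ f (φ i)) ^ 2) * ‖g‖ ^ 2 := by
        rw [← pow_two]
        exact h2.trans (mul_le_mul_of_nonneg_left h3 (Finset.sum_nonneg fun i _ => sq_nonneg _))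
      exact le_of_mul_le_mul_right h4 hpos
  have hs : Summable fun i => inner ℝ f (φ i) • φ i := by
    refine summable_smul_of_norm_sum_sq_le hb ?_
    simpa [sq_abs] using (h f).summable
  obtain ⟨x, hx⟩ := hs
  suffices x = f by rwa [this] at hx
  refine ext_inner_right ℝ fun g => ?_
  have h1 := hx.mapL ((innerSL ℝ).flip g)
  simp only [ContinuousLinearMap.flip_apply, innerSL_apply_apply, real_inner_smul_left] at h1
  refine h1.unique ?_
  simpa [real_inner_comm g] using hasSum_inner_mul_inner h f g

lemma norm_linearCombination_eq {G X : Type*} [NormedAddCommGroup G] [InnerProductSpace ℝ G]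
    {k : X → H} {g : X → G} (h : ∀ s t, inner ℝ (k s) (k t) = inner ℝ (g s) (g t))
    (x : X →₀ ℝ) :
    ‖Finsupp.linearCombination ℝ g x‖ = ‖Finsupp.linearCombination ℝ k x‖ := by
  rw [← sq_eq_sq₀ (norm_nonneg _) (norm_nonneg _), ← real_inner_self_eq_norm_sq,
    ← real_inner_self_eq_norm_sq, Finsupp.linearCombination_apply, Finsupp.linearCombination_apply]
  simp only [Finsupp.sum, sum_inner, inner_sum, real_inner_smul_left, real_inner_smul_right, h]

/-- Two families with the same Gram matrix, the first one total, are related by an isometry. -/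
lemma exists_isometry_of_gram [CompleteSpace H] {G X : Type*} [NormedAddCommGroup G]
    [InnerProductSpace ℝ G] [CompleteSpace G] {k : X → H} {g : X → G}
    (hk : DenseRange (Finsupp.linearCombination ℝ k))
    (h : ∀ s t, inner ℝ (k s) (k t) = inner ℝ (g s) (g t)) :
    ∃ W : H →L[ℝ] G, (∀ s, W (k s) = g s) ∧ ∀ f, ‖W f‖ = ‖f‖ := by
  have hn : ∃ C, ∀ x, ‖Finsupp.linearCombination ℝ g x‖ ≤
      C * ‖Finsupp.linearCombination ℝ k x‖ :=
    ⟨1, fun x => by rw [one_mul, norm_linearCombination_eq h]⟩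
  have hW := LinearMap.extendOfNorm_eq hk hn
  refine ⟨(Finsupp.linearCombination ℝ g).extendOfNorm (Finsupp.linearCombination ℝ k), ?_, ?_⟩
  · intro s
    simpa using hW (Finsupp.single s 1)
  · intro f
    refine hk.induction_on (p := fun f => ‖_‖ = ‖f‖) f ?_ ?_
    · exact isClosed_eq (by fun_prop) (by fun_prop)
    · intro x
      rw [hW, norm_linearCombination_eq h]

end Hilbert

/-! ### The cutoff function and the needlets -/

section Cutoff

variable {κ : ℝ → ℝ}

lemma IsCutoff.eq_zero_of_le (hκ : IsCutoff κ) {t : ℝ} (ht : t ≤ 1 / 2) : κ t = 0 := by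
  obtain ⟨r, _, hr⟩ := hκ.smooth
  have hcl : IsClosed {t | κ t = 0} := isClosed_eq hr.continuous continuous_const
  have hsub : Set.Iio (1 / 2 : ℝ) ⊆ {t | κ t = 0} := fun t ht =>
    image_eq_zero_of_notMem_tsupport (by rw [hκ.support]; exact fun h => (not_le.2 ht) h.1)
  have := hcl.closure_subset_iff.2 hsub
  rw [closure_Iio] at this
  exact this ht

lemma IsCutoff.eq_zero_of_ge (hκ : IsCutoff κ) {t : ℝ} (ht : 2 ≤ t) : κ t = 0 := by
  obtain ⟨r, _, hr⟩ := hκ.smooth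
  have hcl : IsClosed {t | κ t = 0} := isClosed_eq hr.continuous continuous_const
  have hsub : Set.Ioi (2 : ℝ) ⊆ {t | κ t = 0} := fun t ht =>
    image_eq_zero_of_notMem_tsupport (by rw [hκ.support]; exact fun h => (not_le.2 ht) h.2)
  have := hcl.closure_subset_iff.2 hsub
  rw [closure_Ioi] at this
  exact this ht

lemma levelWeight_eq_zero_of_ge (hκ : IsCutoff κ) {j l : ℕ} (h : 2 ^ j ≤ l) :
    levelWeight κ j l = 0 := by
  refine hκ.eq_zero_of_ge ?_
  rw [le_div_iff₀ (by positivity)]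
  have : (2 : ℝ) ^ j ≤ l := by exact_mod_cast h
  linarith

lemma levelWeight_eq_zero_of_le (hκ : IsCutoff κ) {j l : ℕ} (h : 2 * (2 * l + 1) ≤ 2 ^ j) :
    levelWeight κ j l = 0 := by
  refine hκ.eq_zero_of_le ?_
  rw [div_le_iff₀ (by positivity)]
  have : 2 * (2 * (l : ℝ) + 1) ≤ 2 ^ j := by exact_mod_cast h
  linarith

/-- The squares of the cutoffs form a partition of unity in the level. -/
lemma hasSum_levelWeight_sq (hκ : IsCutoff κ) (l : ℕ) :
    HasSum (fun j => levelWeight κ j l ^ 2) 1 := by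
  -- the only levels that contribute at `l` are `j₀` and `j₀ + 1`
  set j₀ := Nat.log 2 (2 * l + 1)
  have h1 : 2 ^ j₀ ≤ 2 * l + 1 := Nat.pow_log_le_self 2 (by omega)
  have h2 : 2 * l + 1 < 2 ^ (j₀ + 1) := Nat.lt_pow_succ_log_self (by norm_num) _
  have h1' : (2 : ℝ) ^ j₀ ≤ 2 * l + 1 := by exact_mod_cast h1
  have h2' : (2 * l + 1 : ℝ) < 2 ^ (j₀ + 1) := by exact_mod_cast h2
  have hsum : ∑ j ∈ {j₀, j₀ + 1}, levelWeight κ j l ^ 2 = 1 := by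
    rw [Finset.sum_pair (by omega)]
    have hp := hκ.partition ((2 * l + 1) / 2 ^ (j₀ + 1)) ⟨by
      rw [le_div_iff₀ (by positivity), pow_succ]; linarith, by
      rw [div_le_one (by positivity)]; exact h2'.le⟩
    have e : 2 * ((2 * (l : ℝ) + 1) / 2 ^ (j₀ + 1)) = (2 * l + 1) / 2 ^ j₀ := by
      rw [pow_succ]; field_simp
    rw [e, sq_abs, sq_abs] at hp
    rw [levelWeight, levelWeight, add_comm]
    exact hp
  rw [← hsum]
  refine hasSum_sum_of_ne_finset_zero fun j hj => ?_
  simp only [Finset.mem_insert, Finset.mem_singleton, not_or] at hj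
  rcases lt_or_gt_of_ne hj.1 with h | h
  · have : levelWeight κ j l = 0 := by
      refine hκ.eq_zero_of_ge ?_
      rw [le_div_iff₀ (by positivity), ← pow_succ']
      exact (pow_le_pow_right₀ (by norm_num) (by omega)).trans h1'
    rw [this]; ring
  · have : levelWeight κ j l = 0 := by
      refine levelWeight_eq_zero_of_le hκ ?_
      have h3 : 2 ^ (j₀ + 1 + 1) ≤ 2 ^ j := Nat.pow_le_pow_right (by norm_num) (by omega)
      rw [pow_succ] at h3
      omega
    rw [this]; ring

lemma needlet_eq_sum (hκ : IsCutoff κ) (j : ℕ) (w : ℝ) (x s : S2) :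
    needlet κ j w x s =
      ∑ i ∈ harmIdx (2 ^ j), Real.sqrt w * levelWeight κ j i.1 * harm i x * harm i s := by
  rw [needlet, sum_harmIdx, tsum_eq_sum (s := Finset.range (2 ^ j)), Finset.mul_sum]
  · refine Finset.sum_congr rfl fun l _ => ?_
    rw [Finset.mul_sum, Finset.mul_sum]
    refine Finset.sum_congr rfl fun m _ => ?_
    simp only [harm]; ring
  · intro l hl
    rw [levelWeight_eq_zero_of_ge hκ (by simpa using hl), zero_mul]

lemma modNeedlet_eq_sum (hκ : IsCutoff κ) (A : ℕ → ℝ) (j : ℕ) (w : ℝ) (x s : S2) :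
    modNeedlet κ A j w x s = ∑ i ∈ harmIdx (2 ^ j),
      Real.sqrt w * levelWeight κ j i.1 * harm i x * (Real.sqrt (A i.1) * harm i s) := by
  rw [modNeedlet, sum_harmIdx, tsum_eq_sum (s := Finset.range (2 ^ j)), Finset.mul_sum]
  · refine Finset.sum_congr rfl fun l _ => ?_
    rw [mul_assoc, ← zonal_eq_legendre, zonal, Finset.mul_sum, Finset.mul_sum]
    refine Finset.sum_congr rfl fun m _ => ?_
    simp only [harm]; ring
  · intro l hl
    rw [levelWeight_eq_zero_of_ge hκ (by simpa using hl)]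
    ring

lemma modNeedlet_eq_sum_harm (hκ : IsCutoff κ) (A : ℕ → ℝ) (j : ℕ) (w : ℝ) (x s : S2) :
    modNeedlet κ A j w x s = ∑ i ∈ harmIdx (2 ^ j),
      (Real.sqrt w * levelWeight κ j i.1 * harm i x * Real.sqrt (A i.1)) * harm i s := by
  rw [modNeedlet_eq_sum hκ]
  exact Finset.sum_congr rfl fun i _ => by ring

lemma continuous_needlet (hκ : IsCutoff κ) (j : ℕ) (w : ℝ) (x : S2) :
    Continuous (needlet κ j w x) := by
  rw [funext (needlet_eq_sum hκ j w x)]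
  exact continuous_finsetSum _ fun i _ => continuous_const.mul (continuous_harm i)

lemma continuous_modNeedlet (hκ : IsCutoff κ) (A : ℕ → ℝ) (j : ℕ) (w : ℝ) (x : S2) :
    Continuous (modNeedlet κ A j w x) := by
  rw [funext (modNeedlet_eq_sum_harm hκ A j w x)]
  exact continuous_finsetSum _ fun i _ => continuous_const.mul (continuous_harm i)

lemma memLp_surf {f : S2 → ℝ} (hf : Continuous f) : MemLp f 2 surf :=
  hf.memLp_of_hasCompactSupport (HasCompactSupport.of_compactSpace f)

/-- Modified needlets at non-adjacent levels are orthogonal, having disjoint spectral supports. -/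
lemma integral_modNeedlet_mul_of_le (hκ : IsCutoff κ) (A : ℕ → ℝ) {j j' : ℕ} (h : j + 2 ≤ j')
    (w w' : ℝ) (x x' : S2) :
    ∫ s, modNeedlet κ A j w x s * modNeedlet κ A j' w' x' s ∂surf = 0 := by
  have e : ∀ s, modNeedlet κ A j w x s * modNeedlet κ A j' w' x' s =
      ∑ i ∈ harmIdx (2 ^ j'),
        (Real.sqrt w' * levelWeight κ j' i.1 * harm i x' * Real.sqrt (A i.1)) *
          (modNeedlet κ A j w x s * harm i s) := by
    intro s
    rw [modNeedlet_eq_sum_harm hκ A j' w' x' s, Finset.mul_sum]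
    exact Finset.sum_congr rfl fun i _ => by ring
  simp_rw [e]
  rw [integral_finsetSum]
  · refine Finset.sum_eq_zero fun i _ => ?_
    rw [integral_const_mul]
    simp_rw [modNeedlet_eq_sum_harm hκ A j w x]
    rw [integral_sum_harm_mul]
    split_ifs with hi
    · rw [mem_harmIdx] at hi
      rw [levelWeight_eq_zero_of_le hκ (j := j') (l := i.1)]
      · ring
      · have h3 : 2 ^ (j + 1 + 1) ≤ 2 ^ j' := Nat.pow_le_pow_right (by norm_num) (by omega)
        rw [pow_succ, pow_succ] at h3
        omega
    · ring
  · intro i _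
    exact integrable_surf (continuous_const.mul
      ((continuous_modNeedlet hκ A j w x).mul (continuous_harm i)))

/-- Modified needlets are orthogonal to polynomials of degree below their spectral support. -/
lemma integral_modNeedlet_mul_polyEval (hκ : IsCutoff κ) (A : ℕ → ℝ) {j : ℕ} (hj : 1 ≤ j)
    (w : ℝ) (x : S2) (p : MvPolynomial (Fin 3) ℝ)
    (hp : (p.totalDegree : ℝ) < ((2 : ℝ) ^ (j - 1) - 1) / 2) :
    ∫ s, modNeedlet κ A j w x s * polyEval p s ∂surf = 0 := by
  have e : ∀ s, modNeedlet κ A j w x s * polyEval p s = ∑ i ∈ harmIdx (2 ^ j),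
      (Real.sqrt w * levelWeight κ j i.1 * harm i x * Real.sqrt (A i.1)) *
        (polyEval p s * harm i s) := by
    intro s
    rw [modNeedlet_eq_sum_harm hκ A j w x s, Finset.sum_mul]
    exact Finset.sum_congr rfl fun i _ => by ring
  simp_rw [e]
  rw [integral_finsetSum]
  · refine Finset.sum_eq_zero fun i _ => ?_
    rw [integral_const_mul]
    by_cases hi : p.totalDegree < i.1
    · rw [integral_mul_harm_of_lt (polyEval_mem_polySpace le_rfl) hi, mul_zero]
    · have hle : (i.1 : ℝ) ≤ p.totalDegree := by exact_mod_cast not_lt.1 hi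
      have h1 : (2 * (i.1 : ℝ) + 1) ≤ 2 ^ (j - 1) := by linarith
      have h2 : 2 * i.1 + 1 ≤ 2 ^ (j - 1) := by exact_mod_cast h1
      have h3 : 2 ^ j = 2 ^ (j - 1) * 2 := by rw [← pow_succ]; congr 1; omega
      rw [levelWeight_eq_zero_of_le hκ (j := j) (l := i.1) (by omega)]
      ring
  · intro i _
    exact integrable_surf (continuous_const.mul ((continuous_polyEval p).mul (continuous_harm i)))

/-- The quadrature rule at level `j` is exact for squares of polynomials of degree `2 ^ j - 1`. -/
lemma IsQuadrature.sum_sq {n : ℕ → ℕ} {lam : (j : ℕ) → Fin (n j) → ℝ}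
    {ξ : (j : ℕ) → Fin (n j) → S2} (hq : IsQuadrature n lam ξ) (j : ℕ)
    (c : (Σ ℓ : ℕ, MIndex ℓ) → ℝ) :
    ∑ k, lam j k * (∑ i ∈ harmIdx (2 ^ j), c i * harm i (ξ j k)) ^ 2 =
      ∑ i ∈ harmIdx (2 ^ j), c i ^ 2 := by
  have hN : 2 ^ j - 1 + 1 = 2 ^ j := Nat.sub_add_cancel Nat.one_le_two_pow
  have h1 := sum_harm_mem_polySpace (2 ^ j - 1) c
  rw [hN] at h1
  have h2 := mul_mem_polySpace h1 h1
  obtain ⟨p, hp, hpe⟩ := exists_polyEval_of_mem h2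
  have h3 := hq.exact_poly j p (by omega)
  rw [← hpe] at h3
  rw [← integral_sum_harm_sq]
  simp only [pow_two]
  exact h3.symm

end Cutoff

/-! ### Frames of a reproducing kernel Hilbert space from frames of a feature space -/

section Feature

variable {X G : Type*} [NormedAddCommGroup G] [InnerProductSpace ℝ G]

/-- The kernel with feature map `g`. -/
noncomputable def gramKernel (g : X → G) : Matrix X X (ℝ →L[ℝ] ℝ) :=
  Matrix.of fun s t => inner ℝ (g s) (g t) • ContinuousLinearMap.id ℝ ℝ

lemma posSemidef_gramKernel (g : X → G) : (gramKernel g).PosSemidef := by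
  have htfae := (RKHS.posSemidef_tfae (K := gramKernel g)).out 0 2
  refine htfae.2 ⟨?_, fun w => ?_⟩
  · ext s t
    simp [gramKernel, real_inner_comm, ContinuousLinearMap.star_eq_adjoint,
      ContinuousLinearMap.adjoint_id]
  · have h : (w.sum fun x a => w.sum fun x' a' => inner ℝ (gramKernel g x' x a) a') =
        inner ℝ (w.sum fun x a => a • g x) (w.sum fun x a => a • g x) := by
      simp only [Finsupp.sum, sum_inner, inner_sum]
      refine Finset.sum_congr rfl fun x _ => Finset.sum_congr rfl fun x' _ => ?_
      simp only [gramKernel, Matrix.of_apply, real_inner_smul_right, _root_.smul_apply,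
        ContinuousLinearMap.id_apply, smul_eq_mul, real_inner_comm (g x)]
      simp
      ring
    rw [h, real_inner_self_eq_norm_sq]
    exact sq_nonneg _

variable [CompleteSpace G]

/-- A Parseval family `ν` in the feature space yields the Parseval frame of the reproducing kernel
Hilbert space that consists of the functions `s ↦ ⟪ν i, g s⟫`. -/
lemma exists_isParsevalFrame_gramKernel {ι : Type*} (g : X → G) {ν : ι → G}
    (hν : ∀ a : G, HasSum (fun i => |inner ℝ a (ν i)| ^ 2) (‖a‖ ^ 2))
    [Fact (gramKernel g).PosSemidef] :
    ∃ φ : ι → RKHS.OfKernel (gramKernel g), (∀ i s, φ i s = inner ℝ (ν i) (g s)) ∧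
      IsParsevalFrame φ := by
  set H := RKHS.OfKernel (gramKernel g)
  set k : X → H := fun s => RKHS.kerFun H s 1 with hkdef
  have hgram : ∀ s t, inner ℝ (k s) (k t) = inner ℝ (g s) (g t) := by
    intro s t
    rw [hkdef, ← RKHS.kernel_inner, RKHS.OfKernel.kernel_ofKernel]
    simp [gramKernel, real_inner_comm]
  have hdense : DenseRange (Finsupp.linearCombination ℝ k) := by
    have h := RKHS.kerFun_dense (H := H)
    rw [DenseRange, ← LinearMap.coe_range, Finsupp.range_linearCombination,
      ← Submodule.dense_iff_topologicalClosure_eq_top] at *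
    refine h.mono ?_
    refine Submodule.span_le.2 ?_
    rintro _ ⟨x, v, rfl⟩
    have e : RKHS.kerFun H x v = v • k x := by
      rw [hkdef]; simp only; rw [← map_smul, smul_eq_mul, mul_one]
    rw [e]
    exact Submodule.smul_mem _ _ (Submodule.subset_span ⟨x, rfl⟩)
  obtain ⟨W, hW, hiso⟩ := exists_isometry_of_gram hdense hgram
  refine ⟨fun i => ContinuousLinearMap.adjoint W (ν i), fun i s => ?_,
    isParsevalFrame_of_parseval fun f => ?_⟩
  · have h := RKHS.inner_kerFun s (1 : ℝ) (ContinuousLinearMap.adjoint W (ν i))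
    rw [ContinuousLinearMap.adjoint_inner_left] at h
    have h' := hW s
    simp only [hkdef] at h'
    rw [h'] at h
    rw [h]
    simp
  · simp_rw [ContinuousLinearMap.adjoint_inner_right]
    rw [← hiso f]
    exact hν (W f)

end Feature

/-! ### The needlets as a Parseval family of coefficient sequences -/

section Coefficients

lemma hasSum_sigma_of_nonneg {γ : ℕ → Type*} [∀ j, Fintype (γ j)] {f : (Σ j, γ j) → ℝ} {a : ℝ}
    (hf : ∀ p, 0 ≤ f p) (h : HasSum (fun j => ∑ k, f ⟨j, k⟩) a) : HasSum f a := by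
  have hs : Summable f := by
    refine (summable_sigma_of_nonneg hf).2 ⟨fun j => (hasSum_fintype _).summable, ?_⟩
    simp_rw [tsum_fintype]
    exact h.summable
  have h2 := hs.hasSum.sigma fun j => hasSum_fintype fun k => f ⟨j, k⟩
  rw [h.unique h2]
  exact hs.hasSum

variable {κ : ℝ → ℝ}

/-- Summing over the levels first, a square-summable sequence keeps its energy under the partition
of unity given by the cutoffs. -/
lemma hasSum_sum_levelWeight_sq_mul (hκ : IsCutoff κ) {c : (Σ ℓ : ℕ, MIndex ℓ) → ℝ} {a : ℝ}
    (hc : ∀ i, 0 ≤ c i) (ha : HasSum c a) :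
    HasSum (fun j => ∑ i ∈ harmIdx (2 ^ j), levelWeight κ j i.1 ^ 2 * c i) a := by
  have h1 : ∀ i : Σ ℓ : ℕ, MIndex ℓ, HasSum (fun j => levelWeight κ j i.1 ^ 2 * c i) (c i) := by
    intro i
    simpa using (hasSum_levelWeight_sq hκ i.1).mul_right (c i)
  have hs : Summable fun q : (Σ ℓ : ℕ, MIndex ℓ) × ℕ => levelWeight κ q.2 q.1.1 ^ 2 * c q.1 := by
    refine (summable_prod_of_nonneg fun q => mul_nonneg (sq_nonneg _) (hc _)).2
      ⟨fun i => (h1 i).summable, ?_⟩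
    simp_rw [(h1 _).tsum_eq]
    exact ha.summable
  have h2 := hs.hasSum.prod_fiberwise h1
  rw [ha.unique h2]
  refine ((Equiv.prodComm _ _).hasSum_iff.2 hs.hasSum).prod_fiberwise fun j => ?_
  refine hasSum_sum_of_ne_finset_zero fun i hi => ?_
  rw [mem_harmIdx, not_lt] at hi
  simp [levelWeight_eq_zero_of_ge hκ hi]

/-- The coefficients of the needlet in spherical harmonics, as a square-summable sequence. -/
noncomputable def needletCoeff (κ : ℝ → ℝ) (j : ℕ) (w : ℝ) (x : S2) :
    lp (fun _ : Σ ℓ : ℕ, MIndex ℓ => ℝ) 2 := by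
  classical
  exact ∑ i ∈ harmIdx (2 ^ j), lp.single 2 i (Real.sqrt w * levelWeight κ j i.1 * harm i x)

lemma inner_needletCoeff (j : ℕ) (w : ℝ) (x : S2) (a : lp (fun _ : Σ ℓ : ℕ, MIndex ℓ => ℝ) 2) :
    inner ℝ a (needletCoeff κ j w x) =
      ∑ i ∈ harmIdx (2 ^ j), Real.sqrt w * levelWeight κ j i.1 * harm i x * a i := by
  classical
  rw [needletCoeff, inner_sum]
  refine Finset.sum_congr rfl fun i _ => ?_
  rw [lp.inner_single_right]
  simp

/-- At a fixed level, the quadrature rule turns the energy with respect to the needlets into the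
energy of the cut-off coefficients. -/
lemma sum_inner_needletCoeff_sq {n : ℕ → ℕ} {lam : (j : ℕ) → Fin (n j) → ℝ}
    {ξ : (j : ℕ) → Fin (n j) → S2} (hq : IsQuadrature n lam ξ)
    (a : lp (fun _ : Σ ℓ : ℕ, MIndex ℓ => ℝ) 2) (j : ℕ) :
    ∑ k, |inner ℝ a (needletCoeff κ j (lam j k) (ξ j k))| ^ 2 =
      ∑ i ∈ harmIdx (2 ^ j), levelWeight κ j i.1 ^ 2 * a i ^ 2 := by
  have h := hq.sum_sq j fun i => levelWeight κ j i.1 * a i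
  simp only [mul_pow] at h
  rw [← h]
  refine Finset.sum_congr rfl fun k _ => ?_
  rw [sq_abs, inner_needletCoeff, ← Real.sq_sqrt (hq.lam_pos j k).le, ← mul_pow, Finset.mul_sum,
    Real.sqrt_sq (Real.sqrt_nonneg _)]
  congr 1
  exact Finset.sum_congr rfl fun i _ => by ring

lemma hasSum_inner_needletCoeff_sq (hκ : IsCutoff κ) {n : ℕ → ℕ} {lam : (j : ℕ) → Fin (n j) → ℝ}
    {ξ : (j : ℕ) → Fin (n j) → S2} (hq : IsQuadrature n lam ξ)
    (a : lp (fun _ : Σ ℓ : ℕ, MIndex ℓ => ℝ) 2) :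
    HasSum (fun p : Σ j, Fin (n j) =>
      |inner ℝ a (needletCoeff κ p.1 (lam p.1 p.2) (ξ p.1 p.2))| ^ 2) (‖a‖ ^ 2) := by
  refine hasSum_sigma_of_nonneg (fun _ => sq_nonneg _) ?_
  have h1 : HasSum (fun i => a i ^ 2) (‖a‖ ^ 2) := by
    have := lp.hasSum_inner (𝕜 := ℝ) a a
    rw [real_inner_self_eq_norm_sq] at this
    simpa [pow_two] using this
  simp_rw [sum_inner_needletCoeff_sq hq a]
  exact hasSum_sum_levelWeight_sq_mul hκ (fun i => sq_nonneg _) h1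

end Coefficients

/-! ### The covariance function -/

section Covariance

/-- The coefficients of the random field at a point with respect to its Gaussian variables. -/
noncomputable def amp (A : ℕ → ℝ) (s : S2) (i : Σ ℓ : ℕ, MIndex ℓ) : ℝ :=
  Real.sqrt (A i.1) * harm i s

variable {A : ℕ → ℝ}

lemma tendsto_harmIdx_atTop : Tendsto harmIdx atTop atTop := by
  refine tendsto_atTop_finset_of_monotone (fun a b hab i hi => ?_) fun i => ⟨i.1 + 1, ?_⟩
  · rw [mem_harmIdx] at hi ⊢
    omega
  · rw [mem_harmIdx]
    omega

/-- By the addition theorem, the energy of the coefficients in each degree does not depend on the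
point. -/
lemma hasSum_amp_sq (hA : ∀ ℓ, 0 ≤ A ℓ) (hAsum : Summable fun ℓ : ℕ => (2 * (ℓ : ℝ) + 1) * A ℓ)
    (s : S2) :
    HasSum (fun i => amp A s i ^ 2) ((∑' ℓ : ℕ, (2 * (ℓ : ℝ) + 1) * A ℓ) / (4 * Real.pi)) := by
  refine hasSum_sigma_of_nonneg (fun _ => sq_nonneg _) ?_
  have e : (fun l : ℕ => ∑ m : MIndex l, amp A s ⟨l, m⟩ ^ 2) =
      fun l : ℕ => (2 * (l : ℝ) + 1) * A l / (4 * Real.pi) := by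
    ext l
    have h := zonal_self l s
    rw [zonal] at h
    simp only [amp, mul_pow, Real.sq_sqrt (hA l), ← Finset.mul_sum, harm]
    simp only [pow_two, h]
    ring
  rw [e]
  exact hAsum.hasSum.div_const _

/-- The coefficients of the random field at a point, as a square-summable sequence. -/
noncomputable def ampVec (hA : ∀ ℓ, 0 ≤ A ℓ)
    (hAsum : Summable fun ℓ : ℕ => (2 * (ℓ : ℝ) + 1) * A ℓ) (s : S2) :
    lp (fun _ : Σ ℓ : ℕ, MIndex ℓ => ℝ) 2 :=
  ⟨amp A s, memℓp_gen (by simpa using (hasSum_amp_sq hA hAsum s).summable)⟩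

lemma inner_needletCoeff_ampVec {κ : ℝ → ℝ} (hκ : IsCutoff κ) (hA : ∀ ℓ, 0 ≤ A ℓ)
    (hAsum : Summable fun ℓ : ℕ => (2 * (ℓ : ℝ) + 1) * A ℓ) (j : ℕ) (w : ℝ) (x s : S2) :
    inner ℝ (needletCoeff κ j w x) (ampVec hA hAsum s) = modNeedlet κ A j w x s := by
  rw [real_inner_comm, inner_needletCoeff, modNeedlet_eq_sum hκ]
  rfl

variable {Ω : Type*} [MeasurableSpace Ω] {P : Measure Ω} {u : Ω → S2 → ℝ}

lemma IsIsotropicGaussianField.exists_isMeanSquareLimit (hu : IsIsotropicGaussianField P A u) :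
    ∃ y : (Σ ℓ : ℕ, MIndex ℓ) → Ω → ℝ, IsIIDStdNormal P y ∧
      ∀ s, IsMeanSquareLimit P y harmIdx atTop (amp A s) fun ω => u ω s := by
  obtain ⟨y, hy, h⟩ := hu.expansion
  refine ⟨y, hy, fun s => ⟨?_, ?_⟩⟩
  · exact (hu.measurable.comp (measurable_id.prodMk measurable_const)).aestronglyMeasurable
  · refine (h s).congr fun L => ?_
    congr 1
    ext ω
    rw [sum_harmIdx]
    congr 1
    refine Finset.sum_congr rfl fun l _ => ?_
    rw [Finset.mul_sum]
    refine Finset.sum_congr rfl fun m _ => ?_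
    simp only [amp, harm]
    ring

lemma inner_ampVec [IsProbabilityMeasure P] (hu : IsIsotropicGaussianField P A u)
    (hA : ∀ ℓ, 0 ≤ A ℓ) (hAsum : Summable fun ℓ : ℕ => (2 * (ℓ : ℝ) + 1) * A ℓ) (s t : S2) :
    inner ℝ (ampVec hA hAsum s) (ampVec hA hAsum t) = covFun P u s t := by
  obtain ⟨y, hy, h⟩ := hu.exists_isMeanSquareLimit
  have h1 := (lp.hasSum_inner (𝕜 := ℝ) (ampVec hA hAsum s) (ampVec hA hAsum t)).comp
    tendsto_harmIdx_atTop
  refine tendsto_nhds_unique h1 (((h s).tendsto_sum_mul hy (h t)).congr fun L => ?_)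
  refine Finset.sum_congr rfl fun i _ => ?_
  change _ = inner ℝ (amp A s i) (amp A t i)
  simp [mul_comm]

lemma covKernel_eq_gramKernel [IsProbabilityMeasure P] (hu : IsIsotropicGaussianField P A u)
    (hA : ∀ ℓ, 0 ≤ A ℓ) (hAsum : Summable fun ℓ : ℕ => (2 * (ℓ : ℝ) + 1) * A ℓ) :
    covKernel P u = gramKernel (ampVec hA hAsum) := by
  ext s t
  simp [covKernel, gramKernel, inner_ampVec hu]

variable {κ : ℝ → ℝ} {n : ℕ → ℕ} {lam : (j : ℕ) → Fin (n j) → ℝ} {ξ : (j : ℕ) → Fin (n j) → S2}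

/-- The modified needlets are a Parseval frame of the reproducing kernel Hilbert space. -/
theorem exists_isParsevalFrame_covKernel [IsProbabilityMeasure P]
    (hu : IsIsotropicGaussianField P A u) (hA : ∀ ℓ, 0 ≤ A ℓ)
    (hAsum : Summable fun ℓ : ℕ => (2 * (ℓ : ℝ) + 1) * A ℓ) (hq : IsQuadrature n lam ξ)
    (hκ : IsCutoff κ) :
    ∃ _ : Fact (covKernel P u).PosSemidef,
      ∃ φ : (Σ j : ℕ, Fin (n j)) → RKHS.OfKernel (covKernel P u),
        (∀ (i : Σ j : ℕ, Fin (n j)) (s : S2),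
          φ i s = modNeedlet κ A i.1 (lam i.1 i.2) (ξ i.1 i.2) s) ∧
        IsParsevalFrame φ := by
  rw [covKernel_eq_gramKernel hu hA hAsum]
  refine ⟨⟨posSemidef_gramKernel _⟩, ?_⟩
  have : Fact (gramKernel (ampVec hA hAsum)).PosSemidef := ⟨posSemidef_gramKernel _⟩
  obtain ⟨φ, h1, h2⟩ := exists_isParsevalFrame_gramKernel (ampVec hA hAsum)
    (hasSum_inner_needletCoeff_sq hκ hq)
  exact ⟨φ, fun i s => by rw [h1, inner_needletCoeff_ampVec hκ], h2⟩

/-- The modified needlets factorize the covariance function. -/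
theorem hasSum_modNeedlet_mul [IsProbabilityMeasure P]
    (hu : IsIsotropicGaussianField P A u) (hA : ∀ ℓ, 0 ≤ A ℓ)
    (hAsum : Summable fun ℓ : ℕ => (2 * (ℓ : ℝ) + 1) * A ℓ) (hq : IsQuadrature n lam ξ)
    (hκ : IsCutoff κ) (s t : S2) :
    HasSum (fun p : Σ j, Fin (n j) => modNeedlet κ A p.1 (lam p.1 p.2) (ξ p.1 p.2) s *
      modNeedlet κ A p.1 (lam p.1 p.2) (ξ p.1 p.2) t) (covFun P u s t) := by
  have h := hasSum_inner_mul_inner (hasSum_inner_needletCoeff_sq hκ hq) (ampVec hA hAsum s)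
    (ampVec hA hAsum t)
  rw [inner_ampVec hu] at h
  simpa only [real_inner_comm (needletCoeff _ _ _ _), inner_needletCoeff_ampVec hκ] using h

lemma covFun_self [IsProbabilityMeasure P] (hu : IsIsotropicGaussianField P A u)
    (hA : ∀ ℓ, 0 ≤ A ℓ) (hAsum : Summable fun ℓ : ℕ => (2 * (ℓ : ℝ) + 1) * A ℓ) (s : S2) :
    covFun P u s s = (∑' ℓ : ℕ, (2 * (ℓ : ℝ) + 1) * A ℓ) / (4 * Real.pi) := by
  rw [← inner_ampVec hu hA hAsum]
  have h := lp.hasSum_inner (𝕜 := ℝ) (ampVec hA hAsum s) (ampVec hA hAsum s)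
  refine h.unique ?_
  have e : (fun i => inner ℝ (ampVec hA hAsum s i) (ampVec hA hAsum s i)) =
      fun i => amp A s i ^ 2 := by
    ext i
    change inner ℝ (amp A s i) (amp A s i) = _
    simp [pow_two]
  rw [e]
  exact hasSum_amp_sq hA hAsum s

/-- The energy of the modified needlets of a given level does not depend on the point. -/
lemma sum_modNeedlet_sq (hA : ∀ ℓ, 0 ≤ A ℓ)
    (hAsum : Summable fun ℓ : ℕ => (2 * (ℓ : ℝ) + 1) * A ℓ) (hq : IsQuadrature n lam ξ)
    (hκ : IsCutoff κ) (j : ℕ) (s : S2) :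
    ∑ k, modNeedlet κ A j (lam j k) (ξ j k) s ^ 2 = ∑ l ∈ Finset.range (2 ^ j),
      levelWeight κ j l ^ 2 * A l * ((2 * (l : ℝ) + 1) / (4 * Real.pi)) := by
  have h := sum_inner_needletCoeff_sq (κ := κ) hq (ampVec hA hAsum s) j
  simp_rw [sq_abs, real_inner_comm (needletCoeff _ _ _ _), inner_needletCoeff_ampVec hκ] at h
  rw [h, sum_harmIdx]
  refine Finset.sum_congr rfl fun l _ => ?_
  rw [← zonal_self l s, zonal, Finset.mul_sum]
  refine Finset.sum_congr rfl fun m _ => ?_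
  change _ * amp A s ⟨l, m⟩ ^ 2 = _
  rw [amp, mul_pow, Real.sq_sqrt (hA l), harm]
  ring

end Covariance

/-! ### Jointly measurable versions of Gaussian series -/

section Version

lemma norm_sub_sum_smul_sq {ι H : Type*} [NormedAddCommGroup H] [InnerProductSpace ℝ H] {e : ι → H}
    (he : Orthonormal ℝ e) {c : ι → ℝ} {a : ℝ} {x : H} (hc : HasSum (fun i => c i ^ 2) a)
    (hx : HasSum (fun i => c i • e i) x) (F : Finset ι) :
    ‖x - ∑ i ∈ F, c i • e i‖ ^ 2 = a - ∑ i ∈ F, c i ^ 2 := by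
  classical
  have h1 : Tendsto (fun G : Finset ι => ‖∑ i ∈ G, c i • e i - ∑ i ∈ F, c i • e i‖ ^ 2) atTop
      (𝓝 (‖x - ∑ i ∈ F, c i • e i‖ ^ 2)) := ((Tendsto.sub_const hx _).norm).pow 2
  have h2 : Tendsto (fun G : Finset ι => ∑ i ∈ G, c i ^ 2 - ∑ i ∈ F, c i ^ 2) atTop
      (𝓝 (a - ∑ i ∈ F, c i ^ 2)) := Tendsto.sub_const hc _
  refine tendsto_nhds_unique (h1.congr' ?_) h2
  filter_upwards [eventually_ge_atTop F] with G hG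
  rw [← Finset.sum_sdiff hG, add_sub_cancel_right, norm_sum_smul_sq_of_orthonormal he,
    ← Finset.sum_sdiff hG, add_sub_cancel_right]

variable {Ω : Type*} [MeasurableSpace Ω] {P : Measure Ω}

/-- Jointly measurable approximations that converge in mean square uniformly in the parameter have a
jointly measurable limit. -/
lemma exists_measurable_limit {T : Type*} [MeasurableSpace T] {v : ℕ → Ω → T → ℝ}
    (hv : ∀ N, Measurable (Function.uncurry (v N))) {V : T → Ω → ℝ}
    (hV : ∀ t, AEStronglyMeasurable (V t) P) {δ : ℕ → ℝ≥0∞} (hδ : Tendsto δ atTop (𝓝 0))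
    (h : ∀ N t, eLpNorm (fun ω => v N ω t - V t ω) 2 P ≤ δ N) :
    ∃ w : Ω → T → ℝ, Measurable (Function.uncurry w) ∧ ∀ t, (fun ω => w ω t) =ᵐ[P] V t := by
  -- along a subsequence with geometric errors the approximations converge almost everywhere
  have hev : ∀ i : ℕ, ∀ᶠ N in atTop, δ N < 2⁻¹ ^ i := fun i =>
    hδ.eventually (gt_mem_nhds (ENNReal.pow_pos (by norm_num) i))
  obtain ⟨φ, hφ, hφ'⟩ := extraction_forall_of_eventually hev
  refine ⟨fun ω t => limsup (fun i => v (φ i) ω t) atTop, ?_, fun t => ?_⟩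
  · exact Measurable.limsup fun i => hv (φ i)
  have hvm : ∀ N, AEStronglyMeasurable (fun ω => v N ω t) P := fun N =>
    ((hv N).comp (measurable_id.prodMk measurable_const)).aestronglyMeasurable
  have hae : ∀ᵐ ω ∂P, ∃ l : ℝ, Tendsto (fun i => v (φ i) ω t) atTop (𝓝 l) := by
    refine Lp.ae_tendsto_of_cauchy_eLpNorm (p := 2) (fun i => hvm (φ i)) (by norm_num)
      (B := fun i => 2⁻¹ ^ i + 2⁻¹ ^ i) ?_ ?_
    · rw [ENNReal.tsum_add, ENNReal.tsum_geometric]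
      norm_num
    · intro N n m hn hm
      have e : (fun ω => v (φ n) ω t) - (fun ω => v (φ m) ω t) =
          (fun ω => v (φ n) ω t - V t ω) + fun ω => V t ω - v (φ m) ω t := by
        ext ω; simp
      have hmono : ∀ k, N ≤ k → (2⁻¹ : ℝ≥0∞) ^ k ≤ 2⁻¹ ^ N := fun k hk =>
        pow_le_pow_right_of_le_one' (by norm_num) hk
      rw [e]
      refine (eLpNorm_add_le ((hvm _).sub (hV t)) ((hV t).sub (hvm _)) (by norm_num)).trans_lt ?_
      refine ENNReal.add_lt_add ?_ ?_
      · exact (h _ t).trans_lt ((hφ' n).trans_le (hmono n hn))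
      · rw [eLpNorm_sub_comm]
        exact (h _ t).trans_lt ((hφ' m).trans_le (hmono m hm))
  have hlim : Tendsto (fun i => eLpNorm (fun ω => v (φ i) ω t - V t ω) 2 P) atTop (𝓝 0) :=
    tendsto_of_tendsto_of_tendsto_of_le_of_le tendsto_const_nhds (hδ.comp hφ.tendsto_atTop)
      (fun _ => zero_le) fun i => h _ t
  obtain ⟨ns, hns, hns'⟩ := (tendstoInMeasure_of_tendsto_eLpNorm (p := 2) (by norm_num)
    (fun i => hvm (φ i)) (hV t) hlim).exists_seq_tendsto_ae
  filter_upwards [hae, hns'] with ω h1 h2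
  obtain ⟨l, hl⟩ := h1
  rw [hl.limsup_eq]
  exact tendsto_nhds_unique (hl.comp hns.tendsto_atTop) h2

lemma isMeanSquareLimit_of_hasSum {ι : Type*} {y : ι → Ω → ℝ} (hy : IsIIDStdNormal P y) {a : ι → ℝ}
    {V : Lp ℝ 2 P} (hV : HasSum (fun i => a i • hy.vec i) V) {X : Ω → ℝ} (hX : X =ᵐ[P] V) :
    IsMeanSquareLimit P y id atTop a X := by
  refine ⟨(Lp.aestronglyMeasurable V).congr hX.symm, ?_⟩
  have hm : MemLp X 2 P := (memLp_congr_ae hX).2 (Lp.memLp V)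
  have e : hm.toLp X = V := by
    rw [← Lp.toLp_coeFn V (Lp.memLp V)]
    exact MemLp.toLp_congr _ _ hX
  have h : Tendsto (fun F : Finset ι => ∑ i ∈ F, a i • hy.vec i) atTop (𝓝 (hm.toLp X)) := by
    rw [e]; exact hV
  simp_rw [← toLp_sum] at h
  rw [Lp.tendsto_Lp_iff_tendsto_eLpNorm''] at h
  refine h.congr fun n => ?_
  exact eLpNorm_sub_comm _ _ _ _

end Version

section Expansion

variable {A : ℕ → ℝ} {Ω : Type*} [MeasurableSpace Ω] {P : Measure Ω} [IsProbabilityMeasure P]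
  {u : Ω → S2 → ℝ} {κ : ℝ → ℝ} {n : ℕ → ℕ} {lam : (j : ℕ) → Fin (n j) → ℝ}
  {ξ : (j : ℕ) → Fin (n j) → S2} {Ω' : Type*} [MeasurableSpace Ω'] {P' : Measure Ω'}
  [IsProbabilityMeasure P'] {z : (Σ j : ℕ, Fin (n j)) → Ω' → ℝ}

/-- The series of modified needlets with independent standard normal coefficients has a jointly
measurable sum. -/
lemma exists_measurable_isMeanSquareLimit (hu : IsIsotropicGaussianField P A u)
    (hA : ∀ ℓ, 0 ≤ A ℓ) (hAsum : Summable fun ℓ : ℕ => (2 * (ℓ : ℝ) + 1) * A ℓ)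
    (hq : IsQuadrature n lam ξ) (hκ : IsCutoff κ) (hz : IsIIDStdNormal P' z) :
    ∃ v : Ω' → S2 → ℝ, Measurable (Function.uncurry v) ∧ ∀ s, IsMeanSquareLimit P' z id atTop
      (fun p => modNeedlet κ A p.1 (lam p.1 p.2) (ξ p.1 p.2) s) fun ω => v ω s := by
  set ψ : S2 → (Σ j : ℕ, Fin (n j)) → ℝ :=
    fun s p => modNeedlet κ A p.1 (lam p.1 p.2) (ξ p.1 p.2) s with hψ
  set K : ℝ := (∑' ℓ : ℕ, (2 * (ℓ : ℝ) + 1) * A ℓ) / (4 * Real.pi)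
  set E : ℕ → ℝ := fun j => ∑ l ∈ Finset.range (2 ^ j),
      levelWeight κ j l ^ 2 * A l * ((2 * (l : ℝ) + 1) / (4 * Real.pi))
  have hsq : ∀ s, HasSum (fun p => ψ s p ^ 2) K := by
    intro s
    have h := hasSum_modNeedlet_mul hu hA hAsum hq hκ s s
    rw [covFun_self hu hA hAsum] at h
    simpa only [← pow_two] using h
  have hE : ∀ s j, ∑ k, ψ s ⟨j, k⟩ ^ 2 = E j := fun s j =>
    sum_modNeedlet_sq hA hAsum hq hκ j s
  have hEsum : HasSum E K := by
    have h := (hsq northPole).sigma fun j => hasSum_fintype fun k => ψ northPole ⟨j, k⟩ ^ 2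
    simpa only [hE] using h
  have hV : ∀ s, ∃ V : Lp ℝ 2 P', HasSum (fun p => ψ s p • hz.vec p) V := fun s =>
    summable_smul_of_norm_sum_sq_le
      (fun F => (norm_sum_smul_sq_of_orthonormal hz.orthonormal_vec (ψ s) F).le) (hsq s).summable
  choose V hV using hV
  have hzm : ∀ p, AEMeasurable (z p) P' := fun p => (hz.law p).aemeasurable
  set lev : ℕ → Finset (Σ j : ℕ, Fin (n j)) := fun N => (Finset.range N).sigma fun _ => Finset.univ
  obtain ⟨v, hvm, hv⟩ := exists_measurable_limit (P := P') (V := fun s => (V s : Ω' → ℝ))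
    (v := fun N ω s => ∑ p ∈ lev N, ψ s p * (hzm p).mk (z p) ω)
    (δ := fun N => ENNReal.ofReal (Real.sqrt (K - ∑ j ∈ Finset.range N, E j)))
    (fun N => by
      refine Finset.measurable_sum _ fun p _ => Measurable.mul ?_ ?_
      · exact (continuous_modNeedlet hκ A _ _ _).measurable.comp measurable_snd
      · exact (hzm p).measurable_mk.comp measurable_fst)
    (fun s => Lp.aestronglyMeasurable _)
    (by
      have h := (hEsum.tendsto_sum_nat.const_sub K).sqrt
      rw [sub_self, Real.sqrt_zero] at h
      simpa using ENNReal.tendsto_ofReal h)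
    (fun N s => by
      have e : (fun ω => ∑ p ∈ lev N, ψ s p * (hzm p).mk (z p) ω - V s ω) =ᵐ[P']
          (((∑ p ∈ lev N, ψ s p • hz.vec p) - V s : Lp ℝ 2 P') : Ω' → ℝ) := by
        have h1 : ∀ᵐ ω ∂P', ∀ p ∈ lev N, z p ω = (hzm p).mk (z p) ω :=
          (Finset.eventually_all (lev N)).2 fun p _ => (hzm p).ae_eq_mk
        rw [← toLp_sum]
        filter_upwards [h1, (memLp_sum hz (lev N) (ψ s)).coeFn_toLp,
          Lp.coeFn_sub ((memLp_sum hz (lev N) (ψ s)).toLp _) (V s)] with ω h1 h2 h3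
        rw [h3, Pi.sub_apply, h2]
        congr 1
        exact Finset.sum_congr rfl fun p hp => by rw [h1 p hp]
      rw [eLpNorm_congr_ae e, ← Lp.enorm_def, ← ofReal_norm]
      refine ENNReal.ofReal_le_ofReal (Real.le_sqrt_of_sq_le ?_)
      rw [norm_sub_rev, norm_sub_sum_smul_sq hz.orthonormal_vec (hsq s) (hV s), Finset.sum_sigma]
      simp only [hE, le_refl])
  exact ⟨v, hvm, fun s => isMeanSquareLimit_of_hasSum hz (hV s) (hv s)⟩

/-- Expansion in law of the random field in the modified needlets. -/
theorem exists_identDistrib_modNeedlet (hu : IsIsotropicGaussianField P A u)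
    (hA : ∀ ℓ, 0 ≤ A ℓ) (hAsum : Summable fun ℓ : ℕ => (2 * (ℓ : ℝ) + 1) * A ℓ)
    (hq : IsQuadrature n lam ξ) (hκ : IsCutoff κ) (hz : IsIIDStdNormal P' z) :
    ∃ v : Ω' → S2 → ℝ, Measurable (Function.uncurry v) ∧
      (∀ s : S2, Tendsto
        (fun F : Finset (Σ j : ℕ, Fin (n j)) => eLpNorm
          (fun ω => v ω s - ∑ i ∈ F,
            z i ω * modNeedlet κ A i.1 (lam i.1 i.2) (ξ i.1 i.2) s) 2 P')
        atTop (𝓝 0)) ∧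
      IdentDistrib (fun ω => u ω) (fun ω => v ω) P P' := by
  obtain ⟨v, hvm, hv⟩ := exists_measurable_isMeanSquareLimit hu hA hAsum hq hκ hz
  obtain ⟨y, hy, hu'⟩ := hu.exists_isMeanSquareLimit
  refine ⟨v, hvm, fun s => (hv s).2.congr fun F => ?_, ?_⟩
  · simp only [id_eq, mul_comm]
  · refine identDistrib_of_isMeanSquareLimit hy hz
      (measurable_pi_lambda _ fun s => hu.measurable.comp (measurable_id.prodMk measurable_const))
      (measurable_pi_lambda _ fun s => hvm.comp (measurable_id.prodMk measurable_const))
      hu' hv fun s t => ?_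
    exact (hasSum_modNeedlet_mul hu hA hAsum hq hκ s t).unique ((hv s).tendsto_sum_mul hz (hv t))

end Expansion

/-! ### Diagonal operators -/

section Diagonal

variable {ι H : Type*} [NormedAddCommGroup H] [InnerProductSpace ℝ H] {e : ι → H} {d : ι → ℝ}

/-- A bounded sequence defines an operator that is diagonal in a given orthonormal family and
vanishes on its orthogonal complement. -/
lemma exists_diagonal [CompleteSpace H] [Countable ι] (he : Orthonormal ℝ e) {C : ℝ}
    (hd : ∀ i, |d i| ≤ C) :
    ∃ S : H →L[ℝ] H, ∀ f, HasSum (fun i => (d i * inner ℝ (e i) f) • e i) (S f) := by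
  have hs : ∀ f, Summable fun i => (d i * inner ℝ (e i) f) • e i := by
    intro f
    refine summable_smul_of_norm_sum_sq_le
      (fun F => (norm_sum_smul_sq_of_orthonormal he _ F).le) ?_
    refine Summable.of_nonneg_of_le (fun _ => sq_nonneg _) (fun i => ?_)
      ((he.inner_products_summable (x := f)).mul_left (C ^ 2))
    rw [mul_pow, ← sq_abs (d i), Real.norm_eq_abs, sq_abs (inner ℝ (e i) f)]
    exact mul_le_mul_of_nonneg_right (pow_le_pow_left₀ (abs_nonneg _) (hd i) 2) (sq_nonneg _)
  choose S hS using hs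
  have hlim : Tendsto (fun (F : Finset ι) (f : H) =>
      (∑ i ∈ F, d i • (innerSL ℝ (e i)).smulRight (e i) : H →L[ℝ] H) f) atTop (𝓝 S) := by
    refine tendsto_pi_nhds.2 fun f => (hS f).congr fun F => ?_
    simp [mul_smul]
  exact ⟨continuousLinearMapOfTendsto _ hlim, hS⟩

variable {S : H →L[ℝ] H}

lemma hasSum_inner_of_diagonal (hS : ∀ f, HasSum (fun i => (d i * inner ℝ (e i) f) • e i) (S f))
    (f g : H) :
    HasSum (fun i => d i * inner ℝ (e i) f * inner ℝ (e i) g) (inner ℝ (S f) g) := by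
  have h := (hS f).mapL ((innerSL ℝ).flip g)
  simpa only [ContinuousLinearMap.flip_apply, innerSL_apply_apply, real_inner_smul_left] using h

lemma isPositive_of_diagonal (hS : ∀ f, HasSum (fun i => (d i * inner ℝ (e i) f) • e i) (S f))
    (hd : ∀ i, 0 ≤ d i) : S.IsPositive := by
  refine ⟨fun f g => ?_, fun f => ?_⟩
  · change inner ℝ (S f) g = inner ℝ f (S g)
    rw [real_inner_comm (S g) f]
    refine (hasSum_inner_of_diagonal hS f g).unique ?_
    simpa only [mul_right_comm] using hasSum_inner_of_diagonal hS g f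
  · refine (hasSum_inner_of_diagonal hS f f).nonneg fun i => ?_
    rw [mul_assoc]
    exact mul_nonneg (hd i) (mul_self_nonneg _)

lemma apply_of_diagonal (he : Orthonormal ℝ e)
    (hS : ∀ f, HasSum (fun i => (d i * inner ℝ (e i) f) • e i) (S f)) (i : ι) :
    S (e i) = d i • e i := by
  classical
  refine (hS (e i)).unique ?_
  have h := hasSum_single (f := fun j => (d j * inner ℝ (e j) (e i)) • e j) i fun j hj => by
    rw [he.2 hj, mul_zero, zero_smul]
  simpa [he.1 i] using h

lemma apply_apply_of_diagonal (he : Orthonormal ℝ e)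
    (hS : ∀ f, HasSum (fun i => (d i * inner ℝ (e i) f) • e i) (S f)) (hd : ∀ i, 0 ≤ d i) (f : H) :
    HasSum (fun i => (d i ^ 2 * inner ℝ (e i) f) • e i) (S (S f)) := by
  have h : ∀ i, inner ℝ (e i) (S f) = d i * inner ℝ (e i) f := by
    intro i
    have h1 := (isPositive_of_diagonal hS hd).1 (e i) f
    change inner ℝ (S (e i)) f = inner ℝ (e i) (S f) at h1
    rw [← h1, apply_of_diagonal he hS, real_inner_smul_left]
  simpa only [h, ← mul_assoc, ← pow_two] using hS (S f)

end Diagonal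

/-! ### The square root of the covariance operator -/

section SquareRoot

/-- The spherical harmonics as elements of `L²(𝕊²)`. -/
noncomputable def harmVec (i : Σ ℓ : ℕ, MIndex ℓ) : Lp ℝ 2 surf :=
  (memLp_surf (continuous_harm i)).toLp (harm i)

lemma orthonormal_harmVec : Orthonormal ℝ harmVec := by
  classical
  rw [orthonormal_iff_ite]
  intro i j
  rw [harmVec, harmVec, inner_toLp, integral_harm_mul]

lemma inner_harmVec (i : Σ ℓ : ℕ, MIndex ℓ) (f : Lp ℝ 2 surf) :
    inner ℝ (harmVec i) f = ∫ t, harm i t * f t ∂surf := by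
  conv_lhs => rw [← Lp.toLp_coeFn f (Lp.memLp f)]
  exact inner_toLp _ _

lemma coeFn_sum_harmVec (s : Finset (Σ ℓ : ℕ, MIndex ℓ)) (c : (Σ ℓ : ℕ, MIndex ℓ) → ℝ) :
    ((∑ i ∈ s, c i • harmVec i : Lp ℝ 2 surf) : S2 → ℝ) =ᵐ[surf]
      fun t => ∑ i ∈ s, c i * harm i t := by
  have h := toLp_finsetSum_mul (fun i => memLp_surf (continuous_harm i)) s c
  simp only [harmVec]
  rw [← h]
  exact MemLp.coeFn_toLp _

/-- If an expansion in spherical harmonics converges both in `L²` and pointwise, the limits agree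
almost everywhere. -/
lemma ae_eq_of_hasSum_harm {c : (Σ ℓ : ℕ, MIndex ℓ) → ℝ} {G : Lp ℝ 2 surf} {g : S2 → ℝ}
    (h1 : HasSum (fun i => c i • harmVec i) G) (h2 : ∀ t, HasSum (fun i => c i * harm i t) (g t)) :
    (G : S2 → ℝ) =ᵐ[surf] g := by
  have h3 : Tendsto (fun N => ∑ i ∈ harmIdx N, c i • harmVec i) atTop (𝓝 G) :=
    h1.comp tendsto_harmIdx_atTop
  obtain ⟨ns, hns, hae⟩ := (tendstoInMeasure_of_tendsto_Lp h3).exists_seq_tendsto_ae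
  have h4 : ∀ᵐ t ∂surf, ∀ N, (∑ i ∈ harmIdx N, c i • harmVec i : Lp ℝ 2 surf) t =
      ∑ i ∈ harmIdx N, c i * harm i t := ae_all_iff.2 fun N => coeFn_sum_harmVec _ c
  filter_upwards [hae, h4] with t h5 h6
  simp_rw [h6] at h5
  exact tendsto_nhds_unique h5
    ((h2 t).comp (tendsto_harmIdx_atTop.comp hns.tendsto_atTop))

variable {A : ℕ → ℝ} {Ω : Type*} [MeasurableSpace Ω] {P : Measure Ω} [IsProbabilityMeasure P]
  {u : Ω → S2 → ℝ}

/-- The expansion of the covariance function in spherical harmonics. -/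
lemma hasSum_covFun (hu : IsIsotropicGaussianField P A u) (hA : ∀ ℓ, 0 ≤ A ℓ)
    (hAsum : Summable fun ℓ : ℕ => (2 * (ℓ : ℝ) + 1) * A ℓ) (s t : S2) :
    HasSum (fun i => A i.1 * harm i s * harm i t) (covFun P u s t) := by
  have h := lp.hasSum_inner (𝕜 := ℝ) (ampVec hA hAsum s) (ampVec hA hAsum t)
  rw [inner_ampVec hu] at h
  have e : (fun i => inner ℝ (ampVec hA hAsum s i) (ampVec hA hAsum t i)) =
      fun i => A i.1 * harm i s * harm i t := by
    ext i
    change inner ℝ (amp A s i) (amp A t i) = _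
    simp only [amp, RCLike.inner_apply, conj_trivial]
    have := Real.mul_self_sqrt (hA i.1)
    linear_combination (harm i s * harm i t) * this
  rwa [e] at h

lemma le_tsum_of_summable (hA : ∀ ℓ, 0 ≤ A ℓ)
    (hAsum : Summable fun ℓ : ℕ => (2 * (ℓ : ℝ) + 1) * A ℓ) (l : ℕ) :
    A l ≤ ∑' ℓ : ℕ, (2 * (ℓ : ℝ) + 1) * A ℓ := by
  have h1 := hAsum.le_tsum l fun i _ => mul_nonneg (by positivity) (hA i)
  have h2 : 0 ≤ 2 * (l : ℝ) * A l := mul_nonneg (by positivity) (hA l)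
  linarith

/-- The expansion of the covariance operator in spherical harmonics, at every point. -/
lemma hasSum_integral_covFun_mul (hu : IsIsotropicGaussianField P A u) (hA : ∀ ℓ, 0 ≤ A ℓ)
    (hAsum : Summable fun ℓ : ℕ => (2 * (ℓ : ℝ) + 1) * A ℓ) (f : Lp ℝ 2 surf) (s : S2) :
    HasSum (fun i => A i.1 * inner ℝ (harmVec i) f * harm i s)
      (∫ t, covFun P u s t * f t ∂surf) := by
  have hs : Summable fun i => (A i.1 * harm i s) • harmVec i := by
    refine summable_smul_of_norm_sum_sq_le
      (fun F => (norm_sum_smul_sq_of_orthonormal orthonormal_harmVec _ F).le) ?_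
    refine Summable.of_nonneg_of_le (fun _ => sq_nonneg _) (fun i => ?_)
      ((hasSum_amp_sq hA hAsum s).summable.mul_left (∑' ℓ : ℕ, (2 * (ℓ : ℝ) + 1) * A ℓ))
    rw [amp, mul_pow, mul_pow, Real.sq_sqrt (hA i.1), pow_two (A i.1), mul_assoc]
    exact mul_le_mul_of_nonneg_right (le_tsum_of_summable hA hAsum i.1)
      (mul_nonneg (hA _) (sq_nonneg _))
  obtain ⟨G, hG⟩ := hs
  have hae := ae_eq_of_hasSum_harm hG (hasSum_covFun hu hA hAsum s)
  have h := hG.mapL ((innerSL ℝ).flip f)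
  simp only [ContinuousLinearMap.flip_apply, innerSL_apply_apply, real_inner_smul_left] at h
  have e : inner ℝ G f = ∫ t, covFun P u s t * f t ∂surf := by
    rw [← Lp.toLp_coeFn f (Lp.memLp f), ← Lp.toLp_coeFn G (Lp.memLp G), inner_toLp]
    refine integral_congr_ae ?_
    filter_upwards [hae, (Lp.memLp f).coeFn_toLp] with t h1 h2
    rw [h1, h2]
  rw [← e]
  simpa only [mul_right_comm] using h

/-- The square root of the covariance operator maps the needlets to the modified needlets. -/
theorem exists_isCovSqrt (hu : IsIsotropicGaussianField P A u) (hA : ∀ ℓ, 0 ≤ A ℓ)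
    (hAsum : Summable fun ℓ : ℕ => (2 * (ℓ : ℝ) + 1) * A ℓ) {κ : ℝ → ℝ} (hκ : IsCutoff κ) :
    ∃ S : Lp ℝ 2 surf →L[ℝ] Lp ℝ 2 surf, IsCovSqrt P A u S ∧
      ∀ (j : ℕ) (w : ℝ) (x : S2), ∃ hψ : MemLp (needlet κ j w x) 2 surf,
        (S (hψ.toLp _) : S2 → ℝ) =ᵐ[surf] modNeedlet κ A j w x := by
  obtain ⟨S, hS⟩ := exists_diagonal orthonormal_harmVec (d := fun i => Real.sqrt (A i.1))
    (C := Real.sqrt (∑' ℓ : ℕ, (2 * (ℓ : ℝ) + 1) * A ℓ)) fun i => by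
      rw [abs_of_nonneg (Real.sqrt_nonneg _)]
      exact Real.sqrt_le_sqrt (le_tsum_of_summable hA hAsum i.1)
  refine ⟨S, ⟨isPositive_of_diagonal hS fun i => Real.sqrt_nonneg _, fun f => ?_, fun f => ?_⟩,
    fun j w x => ⟨memLp_surf (continuous_needlet hκ j w x), ?_⟩⟩
  · have h := apply_apply_of_diagonal orthonormal_harmVec hS (fun i => Real.sqrt_nonneg _) f
    simp only [Real.sq_sqrt (hA _)] at h
    exact ae_eq_of_hasSum_harm h (hasSum_integral_covFun_mul hu hA hAsum f)
  · have h : Tendsto (fun N => ∑ i ∈ harmIdx N,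
        (Real.sqrt (A i.1) * inner ℝ (harmVec i) f) • harmVec i) atTop (𝓝 (S f)) :=
      (hS f).comp tendsto_harmIdx_atTop
    rw [Lp.tendsto_Lp_iff_tendsto_eLpNorm'] at h
    refine h.congr fun L => ?_
    rw [eLpNorm_sub_comm]
    refine eLpNorm_congr_ae ?_
    filter_upwards [coeFn_sum_harmVec (harmIdx L)
      fun i => Real.sqrt (A i.1) * inner ℝ (harmVec i) f] with s hs
    rw [Pi.sub_apply, hs, sum_harmIdx]
    congr 1
    refine Finset.sum_congr rfl fun l _ => ?_
    rw [Finset.mul_sum]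
    refine Finset.sum_congr rfl fun m _ => ?_
    rw [inner_harmVec, mul_assoc]
    rfl
  · set c : (Σ ℓ : ℕ, MIndex ℓ) → ℝ := fun i => Real.sqrt w * levelWeight κ j i.1 * harm i x
    have h1 : (memLp_surf (continuous_needlet hκ j w x)).toLp _ =
        ∑ i ∈ harmIdx (2 ^ j), c i • harmVec i := by
      have h := toLp_finsetSum_mul (fun i => memLp_surf (continuous_harm i)) (harmIdx (2 ^ j)) c
      simp only [harmVec]
      rw [← h]
      exact MemLp.toLp_congr _ _ (Eventually.of_forall fun s => needlet_eq_sum hκ j w x s)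
    rw [h1, map_sum]
    simp_rw [map_smul, apply_of_diagonal orthonormal_harmVec hS, smul_smul]
    filter_upwards [coeFn_sum_harmVec (harmIdx (2 ^ j)) fun i => c i * Real.sqrt (A i.1)] with s hs
    rw [hs, modNeedlet_eq_sum_harm hκ]

end SquareRoot

end SphereNeedlets

theorem theorem3p4 {Ω : Type*} [MeasurableSpace Ω] (P : Measure Ω) [IsProbabilityMeasure P]
    (A : ℕ → ℝ) (hA : ∀ ℓ, 0 ≤ A ℓ) (hAsum : Summable fun ℓ : ℕ => (2 * (ℓ : ℝ) + 1) * A ℓ)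
    (u : Ω → S2 → ℝ) (hu : IsIsotropicGaussianField P A u)
    (n : ℕ → ℕ) (lam : (j : ℕ) → Fin (n j) → ℝ) (ξ : (j : ℕ) → Fin (n j) → S2)
    (hquad : IsQuadrature n lam ξ) (κ : ℝ → ℝ) (hκ : IsCutoff κ) :
    -- the modified needlets are the images of the needlets under the square root of the
    -- covariance operator
    (∃ S : Lp ℝ 2 surf →L[ℝ] Lp ℝ 2 surf, IsCovSqrt P A u S ∧
      ∀ (j : ℕ) (k : Fin (n j)), ∃ hψ : MemLp (needlet κ j (lam j k) (ξ j k)) 2 surf,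
        (S (hψ.toLp _) : S2 → ℝ) =ᵐ[surf] modNeedlet κ A j (lam j k) (ξ j k)) ∧
    -- they are a Parseval frame of the reproducing kernel Hilbert space of the random field
    (∃ _ : Fact (covKernel P u).PosSemidef,
      ∃ φ : (Σ j : ℕ, Fin (n j)) → RKHS.OfKernel (covKernel P u),
        (∀ (i : Σ j : ℕ, Fin (n j)) (s : S2),
          φ i s = modNeedlet κ A i.1 (lam i.1 i.2) (ξ i.1 i.2) s) ∧
        IsParsevalFrame φ) ∧
    -- expansion of the random field, in law, with i.i.d. standard normal coefficients
    (∀ (Ω' : Type*) [MeasurableSpace Ω'] (P' : Measure Ω') [IsProbabilityMeasure P']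
      (z : (Σ j : ℕ, Fin (n j)) → Ω' → ℝ), IsIIDStdNormal P' z →
      ∃ v : Ω' → S2 → ℝ, Measurable (Function.uncurry v) ∧
        (∀ s : S2, Tendsto
          (fun F : Finset (Σ j : ℕ, Fin (n j)) => eLpNorm
            (fun ω => v ω s - ∑ i ∈ F,
              z i ω * modNeedlet κ A i.1 (lam i.1 i.2) (ξ i.1 i.2) s) 2 P')
          atTop (𝓝 0)) ∧
        IdentDistrib (fun ω => u ω) (fun ω => v ω) P P') ∧
    -- orthogonality in `L²` between non-adjacent levels
    (∀ (j : ℕ) (k : Fin (n j)), MemLp (modNeedlet κ A j (lam j k) (ξ j k)) 2 surf) ∧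
    (∀ (j j' : ℕ) (k : Fin (n j)) (k' : Fin (n j')), j + 2 ≤ j' ∨ j' + 2 ≤ j →
      ∫ s, modNeedlet κ A j (lam j k) (ξ j k) s * modNeedlet κ A j' (lam j' k') (ξ j' k') s
        ∂surf = 0) ∧
    -- orthogonality in `L²` to polynomials of low degree
    (∀ (j : ℕ) (k : Fin (n j)), 1 < j → ∀ p : MvPolynomial (Fin 3) ℝ,
      (p.totalDegree : ℝ) < ((2 : ℝ) ^ (j - 1) - 1) / 2 →
      ∫ s, modNeedlet κ A j (lam j k) (ξ j k) s * polyEval p s ∂surf = 0) := by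
  refine ⟨?_, exists_isParsevalFrame_covKernel hu hA hAsum hquad hκ, ?_, ?_, ?_, ?_⟩
  · obtain ⟨S, hS, h⟩ := exists_isCovSqrt hu hA hAsum hκ
    exact ⟨S, hS, fun j k => h j (lam j k) (ξ j k)⟩
  · intro Ω' _ P' _ z hz
    exact exists_identDistrib_modNeedlet hu hA hAsum hquad hκ hz
  · exact fun j k => memLp_surf (continuous_modNeedlet hκ A j _ _)
  · rintro j j' k k' (h | h)
    · exact integral_modNeedlet_mul_of_le hκ A h _ _ _ _
    · simp_rw [mul_comm (modNeedlet κ A j (lam j k) (ξ j k) _)]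
      exact integral_modNeedlet_mul_of_le hκ A h _ _ _ _
  · exact fun j k hj p hp => integral_modNeedlet_mul_polyEval hκ A hj.le _ _ p hp
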